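/- **Setting.** A polynomial probabilistic control-flow graph (pCFG) $\mathcal C$ has a finite set $L$ of locations, real variables $x_1,\dots,x_n$ of which the first $m$ are the output variables ($\mathbf x^{\mathrm{out}}\in\mathbb R^m$ is the projection of $\mathbf x\in\mathbb R^n$), an initial state $(\ell_{\mathrm{init}},\mathbf x_{\mathrm{init}})$, a terminal location $\ell_{\mathrm{out}}$, and finitely many transitions $\tau$, each with a source location, a probability distribution $\mathrm{Pr}$ on successor locations, a guard (a boolean combination of inequalities between expressions) and an update of at most one variable (no update, assignment of a polynomial, or sampling from a distribution $\delta$ on $\mathbb R$). In each state exactly one transition is enabled; the only transition from $\ell_{\mathrm{out}}$ is a self-loop without update. $\mathrm{Next}(\tau,\mathbf x)$ is the random valuation after $\tau$. The runs form a Markov process from the initial state (successor location and valuation are drawn independently), $\mathrm{TimeTerm}$ is the hitting time of $\ell_{\mathrm{out}}$, and, for an almost surely terminating pCFG, $\mu^{\mathcal C}$ is the law of $\mathbf x^{\mathrm{out}}$ at termination. Let $\mathcal C_1,\mathcal C_2$ be two almost surely terminating polynomial pCFGs with the same output variables, with linear guards, whose sampling distributions have all moments finite, and let $I_1,I_2$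 be linear invariants of them (an invariant gives for each location a predicate satisfied by all reachable states there). Let $d$ be the $L^p$ metric (integer $p\ge1$), the discrete metric or the uniform metric on $\mathbb R^m$, let $\mu^{\mathcal C_1},\mu^{\mathcal C_2}$ have finite first moments with respect to $d$, and let $\varepsilon>0$. Let one of the following conditions, chosen for both programs, hold for both: (C1) $\mathrm{TimeTerm}$ is almost surely bounded by a constant; (C2) no requirement; (C3) $\mathbb E[\mathrm{TimeTerm}]<\infty$; (C4) updates change variables by at most a constant, and there are $c_1,c_2\in\mathbb R$ with $c_2>0$ and $\mathbb P(\mathrm{TimeTerm}>k)\le c_1e^{-c_2k}$ for all large $k$. **Algorithm.** The algorithm looks for polynomials of degree at most $D$: $f$ in the output variables, and $U(\ell)$, $V(\ell)$ in the program variables, one for each location $\ell$ of $\mathcal C_1$ and of $\mathcal C_2$ respectively. It collects the following constraints. * $U(\ell_{\mathrm{out}},\mathbf x)=0$ whenever $\mathbf x\models I_1(\ell_{\mathrm{out}})$; and, for every transition $\tau$ of $\mathcal C_1$ from $\ell$ and every $\mathbf x\models I_1(\ell)\wedge G(\tau)$ ($G(\tau)$ being the guard), with $\mathbf N=\mathrm{Next}(\tau,\mathbf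 x)$, $$U(\ell,\mathbf x)\ \ge\ \sum_{\ell'}\mathrm{Pr}(\ell')\,\mathbb E[U(\ell',\mathbf N)+f(\mathbf N^{\mathrm{out}})]-f(\mathbf x^{\mathrm{out}}).\tag{1}$$ * The same for $V$, $\mathcal C_2$, $I_2$, with $\le$ instead of $\ge$ in (1). * Under (C2): for some constant $c>0$, $|U(\ell,\mathbf x)+f(\mathbf x^{\mathrm{out}})|\le c$ for all $\ell$ and $\mathbf x\models I_1(\ell)$. Under (C3): for some $c>0$, the change of $U+f$ in one step by $\tau$ from $\mathbf x\models I_1(\ell)\wedge G(\tau)$, to any location of positive probability and any value in the support of $\mathbf N$, is at most $c$ in absolute value. In both cases the same for $V$, $\mathcal C_2$, $I_2$. * $V(\ell^2_{\mathrm{init}},\mathbf x^2_{\mathrm{init}})+f((\mathbf x^2_{\mathrm{init}})^{\mathrm{out}})-U(\ell^1_{\mathrm{init}},\mathbf x^1_{\mathrm{init}})-f((\mathbf x^1_{\mathrm{init}})^{\mathrm{out}})\ge\varepsilon$. * $f$ is 1-Lipschitz for $d$ on $O=O_1\cup O_2$, where $O_i=\{\mathbf x^{\mathrm{out}}:\mathbf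 x\models I_i(\ell^i_{\mathrm{out}})\}$ contains all reachable outputs of $\mathcal C_i$. For $\mathbf u,\mathbf v\in O$ this is written as follows. For $L^p$: $(f(\mathbf u)-f(\mathbf v))^p\le\sum_j a_j^p$ whenever $|u_j-v_j|\le a_j$ for all $j$. For the discrete metric: $f(\mathbf u)-f(\mathbf v)\le1$. For the uniform metric: $f(\mathbf u)-f(\mathbf v)\le A$ whenever $|u_j-v_j|\le a_j\le A$ for all $j$. Expectations are evaluated symbolically through the moments of the sampling distributions. Premises are put in disjunctive normal form, with strict inequalities relaxed to non-strict ones, and supports of sampling distributions are described by linear inequalities. Each resulting entailment "$h_1\ge0,\dots,h_k\ge0$ imply $g\ge0$" between polynomials is replaced by its Handelman encoding of some degree $K$: $g$ is a combination, with nonnegative coefficients, of products of at most $K$ of the $h_i$. If the resulting system in the coefficients of $f,U,V$ and the auxiliary unknowns is solved, the algorithm answers "Not $\varepsilon$-output close" and returns $f$, $U^1_f=U$ and $L^2_f=V$. **Theorem (Correctness of Similarity Refutation).** Suppose that the algorithm answers "Not $\varepsilon$-output close" and returns $f$, $U^1_f$, $L^2_f$. Then: 1. $f$ is 1-Lipschitz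 for $d$ on $O_1\cup O_2$, in particular on the reachable outputs of the two programs. 2. $U^1_f$ is an upper expectation supermartingale (UESM) for $f$ in $\mathcal C_1$ with respect to $I_1$: it vanishes at $\ell_{\mathrm{out}}$ on $I_1(\ell_{\mathrm{out}})$, the expectations in (1) exist, and (1) holds for all $\tau$ and all $\mathbf x\models I_1(\ell)\wedge G(\tau)$. Likewise $L^2_f$ is a lower expectation submartingale (LESM) for $f$ in $\mathcal C_2$ with respect to $I_2$ (with $\le$ in (1)). 3. The Kantorovich distance $$\mathcal K_d(\mu^{\mathcal C_1},\mu^{\mathcal C_2})=\sup\big\{\,|\mathbb E_{\mu^{\mathcal C_1}}[g]-\mathbb E_{\mu^{\mathcal C_2}}[g]|\ :\ g:\mathbb R^m\to\mathbb R\text{ measurable and 1-Lipschitz for }d\,\big\}$$ is at least $\varepsilon$, i.e. $\mathcal C_1$ and $\mathcal C_2$ are not $\varepsilon$-output close. -/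

import Mathlib

open MeasureTheory ProbabilityTheory
open scoped ENNReal NNReal

/-! ### Predicates over program variables -/

/-- Predicates over `n` real variables: boolean combinations of atoms `E₁ ≤ E₂` whose two sides
are polynomials. -/
inductive PolyPred (n : ℕ) : Type
  | le (p q : MvPolynomial (Fin n) ℝ) : PolyPred n
  | and (P Q : PolyPred n) : PolyPred n
  | or (P Q : PolyPred n) : PolyPred n
  | not (P : PolyPred n) : PolyPred n

namespace PolyPred

variable {n : ℕ}

/-- `P.Holds x` means `x ⊨ P`. -/
def Holds : PolyPred n → (Fin n → ℝ) → Prop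
  | le p q, x => MvPolynomial.eval x p ≤ MvPolynomial.eval x q
  | and P Q, x => P.Holds x ∧ Q.Holds x
  | or P Q, x => P.Holds x ∨ Q.Holds x
  | not P, x => ¬ P.Holds x

/-- All atoms of the predicate are inequalities between linear (affine) expressions. -/
def IsLinear : PolyPred n → Prop
  | le p q => p.totalDegree ≤ 1 ∧ q.totalDegree ≤ 1
  | and P Q => P.IsLinear ∧ Q.IsLinear
  | or P Q => P.IsLinear ∧ Q.IsLinear
  | not P => P.IsLinear

/-- Disjunctive normal form of `P` (for `true`) or of the negation of `P` (for `false`). A clause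
`[g₁, …, gₖ]` stands for the conjunction `g₁ ≥ 0 ∧ … ∧ gₖ ≥ 0`; a strict inequality, which arises
from a negated atom, is relaxed to the corresponding non-strict one. -/
noncomputable def dnf : PolyPred n → Bool → List (List (MvPolynomial (Fin n) ℝ))
  | le p q, true => [[q - p]]
  | le p q, false => [[p - q]]
  | and P Q, true => (P.dnf true).flatMap fun D => (Q.dnf true).map fun E => D ++ E
  | and P Q, false => P.dnf false ++ Q.dnf false
  | or P Q, true => P.dnf true ++ Q.dnf true
  | or P Q, false => (P.dnf false).flatMap fun D => (Q.dnf false).map fun E => D ++ E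
  | not P, true => P.dnf false
  | not P, false => P.dnf true

theorem measurableSet_holds (P : PolyPred n) : MeasurableSet {x | P.Holds x} := by
  induction P with
  | le p q =>
    exact measurableSet_le (MvPolynomial.continuous_eval p).measurable
      (MvPolynomial.continuous_eval q).measurable
  | and P Q hP hQ => exact hP.inter hQ
  | or P Q hP hQ => exact hP.union hQ
  | not P hP => exact hP.compl

end PolyPred

/-! ### Updates of a variable -/

/-- Update of a transition: no update, assignment of a polynomial expression to the variable `j`,
or sampling of the variable `j` from a probability distribution. -/
inductive VarUpdate (n : ℕ) : Type
  | skip : VarUpdate n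
  | assign (j : Fin n) (p : MvPolynomial (Fin n) ℝ) : VarUpdate n
  | sample (j : Fin n) (δ : ProbabilityMeasure ℝ) : VarUpdate n

namespace VarUpdate

variable {n : ℕ}

theorem measurable_assign (j : Fin n) (p : MvPolynomial (Fin n) ℝ) :
    Measurable fun x : Fin n → ℝ => Function.update x j (MvPolynomial.eval x p) := by
  refine measurable_pi_lambda _ fun i => ?_
  by_cases h : i = j
  · subst h
    simpa using (MvPolynomial.continuous_eval p).measurable
  · simpa [Function.update_of_ne h] using measurable_pi_apply i

theorem measurable_sample (j : Fin n) :
    Measurable fun z : (Fin n → ℝ) × ℝ => Function.update z.1 j z.2 := by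
  refine measurable_pi_lambda _ fun i => ?_
  by_cases h : i = j
  · subst h
    simpa using measurable_snd
  · simp only [Function.update_of_ne h]
    exact (measurable_pi_apply i).comp measurable_fst

/-- The law of the successor valuation `Next(τ, x)` of the valuation `x`, as a Markov kernel. -/
noncomputable def next : VarUpdate n → Kernel (Fin n → ℝ) (Fin n → ℝ)
  | skip => Kernel.id
  | assign j p => Kernel.deterministic
      (fun x => Function.update x j (MvPolynomial.eval x p)) (measurable_assign j p)
  | sample j δ => (Kernel.id ×ₖ Kernel.const (Fin n → ℝ) (δ : Measure ℝ)).map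
      fun z => Function.update z.1 j z.2

instance isMarkovKernel_next (u : VarUpdate n) : IsMarkovKernel u.next := by
  cases u with
  | skip => exact inferInstanceAs (IsMarkovKernel Kernel.id)
  | assign j p => exact Kernel.isMarkovKernel_deterministic (measurable_assign j p)
  | sample j δ => exact Kernel.IsMarkovKernel.map _ (measurable_sample j)

/-- The possible values of `Next(τ, x)`. -/
def nextSupport : VarUpdate n → (Fin n → ℝ) → Set (Fin n → ℝ)
  | skip, x => {x}
  | assign j p, x => {Function.update x j (MvPolynomial.eval x p)}
  | sample j δ, x => (fun v => Function.update x j v) '' (δ : Measure ℝ).support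

/-- All moments of the sampled distribution (if any) are finite. -/
def FiniteMoments : VarUpdate n → Prop
  | skip => True
  | assign _ _ => True
  | sample _ δ => ∀ k : ℕ, Integrable (fun v : ℝ => |v| ^ k) (δ : Measure ℝ)

/-- Symbolic evaluation of `𝔼[p(Next(τ, x))]` as a polynomial in `x`: assignments are
substituted, and powers of a sampled variable are replaced by the moments of its distribution. -/
noncomputable def symExp : VarUpdate n → MvPolynomial (Fin n) ℝ → MvPolynomial (Fin n) ℝ
  | skip, p => p
  | assign j q, p => MvPolynomial.bind₁ (Function.update MvPolynomial.X j q) p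
  | sample j δ, p => ∑ α ∈ p.support,
      MvPolynomial.monomial (α.erase j) (p.coeff α * ∫ v, v ^ α j ∂(δ : Measure ℝ))

/-- `Next(τ, x)` as a vector of polynomials in `x` and one additional variable `none`, which
stands for the sampled value. -/
noncomputable def symNext : VarUpdate n → Fin n → MvPolynomial (Option (Fin n)) ℝ
  | skip => fun i => MvPolynomial.X (some i)
  | assign j q => Function.update (fun i => MvPolynomial.X (some i)) j
      (MvPolynomial.rename some q)
  | sample j _ => Function.update (fun i => MvPolynomial.X (some i)) j (MvPolynomial.X none)

/-- The linear inequalities `a · v + b ≥ 0` on the sampled value `v` that hold on the support of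
the sampled distribution (no inequality if nothing is sampled). -/
def supportIneqs : VarUpdate n → Set (MvPolynomial (Option (Fin n)) ℝ)
  | skip => ∅
  | assign _ _ => ∅
  | sample _ δ => {g | ∃ a b : ℝ, (∀ v ∈ (δ : Measure ℝ).support, 0 ≤ a * v + b) ∧
      g = MvPolynomial.C a * MvPolynomial.X none + MvPolynomial.C b}

end VarUpdate

/-! ### Probabilistic control-flow graphs -/

/-- A polynomial probabilistic control-flow graph with locations `L` and variables
`x₀, …, x_{n-1}`, the first `m` of which are the output variables. -/
structure PCFG (L : Type*) (n m : ℕ) where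
  /-- the output variables are among the variables -/
  out_le : m ≤ n
  /-- initial location -/
  lInit : L
  /-- initial valuation -/
  xInit : Fin n → ℝ
  /-- terminal location -/
  lOut : L
  /-- number of transitions -/
  numTrans : ℕ
  /-- source location of a transition -/
  src : Fin numTrans → L
  /-- distribution of the successor location -/
  prob : Fin numTrans → PMF L
  /-- guard of a transition -/
  guard : Fin numTrans → PolyPred n
  /-- update of a transition -/
  update : Fin numTrans → VarUpdate n
  /-- the guards of the transitions from a location are exhaustive and mutually exclusive -/
  existsUnique_enabled : ∀ (ℓ : L) (x : Fin n → ℝ), ∃! τ, src τ = ℓ ∧ (guard τ).Holds x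
  /-- the only transition from the terminal location is a self-loop without update -/
  terminal : ∃ τ, (∀ τ', src τ' = lOut ↔ τ' = τ) ∧ prob τ = PMF.pure lOut ∧
    (∀ x, (guard τ).Holds x) ∧ update τ = VarUpdate.skip

namespace PCFG

variable {L : Type*} {n m : ℕ}

/-- The projection `x ↦ x^out` to the output variables. -/
def out (C : PCFG L n m) (x : Fin n → ℝ) : Fin m → ℝ := fun i => x (Fin.castLE C.out_le i)

/-- The transition `τ` is enabled in the state `s`. -/
def Enabled (C : PCFG L n m) (τ : Fin C.numTrans) (s : L × (Fin n → ℝ)) : Prop :=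
  C.src τ = s.1 ∧ (C.guard τ).Holds s.2

/-- `s'` is a successor of `s`. -/
def Succ (C : PCFG L n m) (s s' : L × (Fin n → ℝ)) : Prop :=
  ∃ τ, C.Enabled τ s ∧ C.prob τ s'.1 ≠ 0 ∧ s'.2 ∈ (C.update τ).nextSupport s.2

/-- There is a finite path from the initial state to `s`. -/
def Reachable (C : PCFG L n m) (s : L × (Fin n → ℝ)) : Prop :=
  Relation.ReflTransGen C.Succ (C.lInit, C.xInit) s

/-- The predicate function `I` is an invariant: it contains all reachable states. -/
def IsInvariant (C : PCFG L n m) (I : L → PolyPred n) : Prop :=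
  ∀ s, C.Reachable s → (I s.1).Holds s.2

/-- All expressions in the guards are linear. -/
def LinearGuards (C : PCFG L n m) : Prop := ∀ τ, (C.guard τ).IsLinear

/-- All distributions in sampling instructions have finite moments. -/
def FiniteMoments (C : PCFG L n m) : Prop := ∀ τ, (C.update τ).FiniteMoments

/-- There is a bound on the change of a variable by an update in a reachable state. -/
def BoundedUpdates (C : PCFG L n m) : Prop :=
  ∃ M : ℝ, 0 < M ∧ ∀ τ s, C.Reachable s → C.Enabled τ s →
    ∀ y ∈ (C.update τ).nextSupport s.2, ∀ j, |y j - s.2 j| ≤ M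

section Semantics

variable [MeasurableSpace L] [DiscreteMeasurableSpace L]

theorem measurableSet_enabled (C : PCFG L n m) (τ : Fin C.numTrans) :
    MeasurableSet {s | C.Enabled τ s} := by
  have h1 : MeasurableSet {s : L × (Fin n → ℝ) | C.src τ = s.1} :=
    measurable_fst (MeasurableSet.of_discrete (s := {ℓ | C.src τ = ℓ}))
  exact h1.inter (measurable_snd (C.guard τ).measurableSet_holds)

/-- One step of the process by the transition `τ`: the successor location and the successor
valuation are drawn independently. -/
noncomputable def transStep (C : PCFG L n m) (τ : Fin C.numTrans) :
    Kernel (L × (Fin n → ℝ)) (L × (Fin n → ℝ)) :=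
  Kernel.const _ (C.prob τ).toMeasure ×ₖ (C.update τ).next.comap Prod.snd measurable_snd

open Classical in
/-- One step of the process: the step by the enabled transition. -/
noncomputable def step (C : PCFG L n m) : Kernel (L × (Fin n → ℝ)) (L × (Fin n → ℝ)) :=
  ∑ τ, Kernel.piecewise (C.measurableSet_enabled τ) (C.transStep τ) 0

theorem step_apply (C : PCFG L n m) {τ : Fin C.numTrans} {s : L × (Fin n → ℝ)}
    (h : C.Enabled τ s) :
    C.step s = (C.prob τ).toMeasure.prod ((C.update τ).next s.2) := by
  classical
  have hu : ∀ τ', C.Enabled τ' s → τ' = τ := fun τ' h' =>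
    (C.existsUnique_enabled s.1 s.2).unique h' h
  rw [step, sum_apply, Finset.sum_eq_single τ]
  · rw [Kernel.piecewise_apply]
    simp only [Set.mem_ofPred_eq, if_pos h]
    rw [transStep, Kernel.prod_apply]
    simp
  · intro τ' _ hne
    rw [Kernel.piecewise_apply]
    have h' : ¬ C.Enabled τ' s := fun h' => hne (hu τ' h')
    simp [h']
  · simp

instance isMarkovKernel_step (C : PCFG L n m) : IsMarkovKernel C.step := by
  refine ⟨fun s => ?_⟩
  obtain ⟨τ, hτ, -⟩ := C.existsUnique_enabled s.1 s.2
  rw [C.step_apply (τ := τ) hτ]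
  infer_instance

/-- The law of the run of the process that starts in the initial state. -/
noncomputable def runLaw (C : PCFG L n m) : Measure (ℕ → L × (Fin n → ℝ)) :=
  Kernel.trajMeasure (X := fun _ => L × (Fin n → ℝ)) (Measure.dirac (C.lInit, C.xInit))
    fun k => C.step.comap (fun h => h ⟨k, Finset.mem_Iic.2 le_rfl⟩) (measurable_pi_apply _)

/-- Termination time of a run. -/
noncomputable def termTime (C : PCFG L n m) (ρ : ℕ → L × (Fin n → ℝ)) : ℕ∞ :=
  ⨅ (i : ℕ) (_ : (ρ i).1 = C.lOut), (i : ℕ∞)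

/-- Almost-sure termination. -/
def TerminatesAS (C : PCFG L n m) : Prop := ∀ᵐ ρ ∂C.runLaw, ∃ i, (ρ i).1 = C.lOut

/-- The output of a terminating run. -/
noncomputable def runOut (C : PCFG L n m) (ρ : ℕ → L × (Fin n → ℝ)) : Fin m → ℝ :=
  C.out (ρ (sInf {i | (ρ i).1 = C.lOut})).2

/-- The output distribution. -/
noncomputable def outputLaw (C : PCFG L n m) : Measure (Fin m → ℝ) :=
  (C.runLaw.restrict {ρ | ∃ i, (ρ i).1 = C.lOut}).map C.runOut

end Semantics

/-! ### Expectation super- and submartingales -/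

section Martingales

variable [Fintype L] [MeasurableSpace L] [DiscreteMeasurableSpace L]

/-- The successor expectation `∑ ℓ', Pr(ℓ') · 𝔼[η(ℓ', N) + f(N^out)]`, `N = Next(τ, x)`. -/
noncomputable def nextExp (C : PCFG L n m) (η : L → (Fin n → ℝ) → ℝ) (f : (Fin m → ℝ) → ℝ)
    (τ : Fin C.numTrans) (x : Fin n → ℝ) : ℝ :=
  ∑ ℓ', (C.prob τ ℓ').toReal * ∫ N, (η ℓ' N + f (C.out N)) ∂(C.update τ).next x

/-- `U` is an upper expectation supermartingale for `f` with respect to the invariant `I`. The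
expectations in the defining inequality are required to exist. -/
structure IsUESM (C : PCFG L n m) (I : L → PolyPred n) (f : (Fin m → ℝ) → ℝ)
    (U : L → (Fin n → ℝ) → ℝ) : Prop where
  terminates : C.TerminatesAS
  invariant : C.IsInvariant I
  measurable_f : Measurable f
  measurable : ∀ ℓ, Measurable (U ℓ)
  zero_on_output : ∀ x, (I C.lOut).Holds x → U C.lOut x = 0
  integrable : ∀ τ x, (I (C.src τ)).Holds x → (C.guard τ).Holds x → ∀ ℓ', C.prob τ ℓ' ≠ 0 →
    Integrable (fun N => U ℓ' N + f (C.out N)) ((C.update τ).next x)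
  decrease : ∀ τ x, (I (C.src τ)).Holds x → (C.guard τ).Holds x →
    C.nextExp U f τ x - f (C.out x) ≤ U (C.src τ) x

/-- `V` is a lower expectation submartingale for `f` with respect to the invariant `I`. The
expectations in the defining inequality are required to exist. -/
structure IsLESM (C : PCFG L n m) (I : L → PolyPred n) (f : (Fin m → ℝ) → ℝ)
    (V : L → (Fin n → ℝ) → ℝ) : Prop where
  terminates : C.TerminatesAS
  invariant : C.IsInvariant I
  measurable_f : Measurable f
  measurable : ∀ ℓ, Measurable (V ℓ)
  zero_on_output : ∀ x, (I C.lOut).Holds x → V C.lOut x = 0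
  integrable : ∀ τ x, (I (C.src τ)).Holds x → (C.guard τ).Holds x → ∀ ℓ', C.prob τ ℓ' ≠ 0 →
    Integrable (fun N => V ℓ' N + f (C.out N)) ((C.update τ).next x)
  increase : ∀ τ x, (I (C.src τ)).Holds x → (C.guard τ).Holds x →
    V (C.src τ) x ≤ C.nextExp V f τ x - f (C.out x)

end Martingales

/-- The outputs that the invariant `I` allows at the terminal location (an over-approximation of
the reachable outputs). -/
def outputSet (C : PCFG L n m) (I : L → PolyPred n) : Set (Fin m → ℝ) :=
  C.out '' {x | (I C.lOut).Holds x}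

end PCFG

/-! ### Metrics on outputs and the Kantorovich distance -/

/-- The metrics on the output space: `L^p` for an integer `p ≥ 1`, discrete, uniform. -/
inductive OutMetric : Type
  | lp (p : ℕ) (hp : 1 ≤ p) : OutMetric
  | discrete : OutMetric
  | uniform : OutMetric

open Classical in
/-- The distance function of a metric on the output space. -/
noncomputable def OutMetric.d {m : ℕ} : OutMetric → (Fin m → ℝ) → (Fin m → ℝ) → ℝ
  | lp p _, x, y => (∑ i, |x i - y i| ^ p) ^ (1 / (p : ℝ))
  | discrete, x, y => if x = y then 0 else 1
  | uniform, x, y => ⨆ i, |x i - y i|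

/-- `μ` has a finite first moment with respect to `d`. -/
def FiniteFirstMoment {m : ℕ} (d : (Fin m → ℝ) → (Fin m → ℝ) → ℝ) (μ : Measure (Fin m → ℝ)) :
    Prop :=
  ∃ x₀, ∫⁻ x, ENNReal.ofReal (d x₀ x) ∂μ < ∞

/-- The Kantorovich distance: the supremum of `|𝔼_μ[g] - 𝔼_ν[g]|` over the (measurable)
functions `g` that are 1-Lipschitz for `d`. All these expectations exist if `μ` and `ν` are finite
measures with finite first moments. -/
noncomputable def kantorovich {m : ℕ} (d : (Fin m → ℝ) → (Fin m → ℝ) → ℝ)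
    (μ ν : Measure (Fin m → ℝ)) : ℝ≥0∞ :=
  ⨆ (g : (Fin m → ℝ) → ℝ) (_ : Measurable g ∧ ∀ x y, |g x - g y| ≤ d x y),
    ENNReal.ofReal |∫ x, g x ∂μ - ∫ x, g x ∂ν|

/-! ### The algorithm -/

/-- The degree-`K` Handelman encoding of the entailment `(∀ h ∈ Γ, h ≥ 0) → g ≥ 0`: the polynomial
`g` is a linear combination, with nonnegative coefficients, of products of at most `K` elements
of `Γ` (repetitions are allowed, and the empty product is `1`). -/
def Handelman {σ : Type*} (K : ℕ) (Γ : Set (MvPolynomial σ ℝ)) (g : MvPolynomial σ ℝ) : Prop :=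
  g ∈ Submodule.span ℝ≥0 {q : MvPolynomial σ ℝ |
    ∃ s : Multiset (MvPolynomial σ ℝ), s.card ≤ K ∧ (∀ h ∈ s, h ∈ Γ) ∧ q = s.prod}

/-- The encoding of `∀ x, x ⊨ P → g x ≥ 0`, one entailment for every clause of `P`. -/
def PolyPred.Encodes {n : ℕ} (K : ℕ) (P : PolyPred n) (g : MvPolynomial (Fin n) ℝ) : Prop :=
  ∀ D ∈ P.dnf true, Handelman K {h | h ∈ D} g

/-- The optional-stopping conditions that the algorithm can impose. -/
inductive OSTMode : Type
  | C1 | C2 | C3 | C4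

/-- What a condition requires of a program. -/
def OSTMode.Requires {L : Type*} [MeasurableSpace L] [DiscreteMeasurableSpace L] {n m : ℕ}
    (C : PCFG L n m) : OSTMode → Prop
  | C1 => ∃ c : ℕ, ∀ᵐ ρ ∂C.runLaw, C.termTime ρ ≤ c
  | C2 => True
  | C3 => ∫⁻ ρ, (C.termTime ρ : ℝ≥0∞) ∂C.runLaw < ∞
  | C4 => C.BoundedUpdates ∧ ∃ c₁ c₂ : ℝ, 0 < c₂ ∧ ∀ᶠ k : ℕ in Filter.atTop,
      C.runLaw.real {ρ | (k : ℕ∞) < C.termTime ρ} ≤ c₁ * Real.exp (-c₂ * k)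

namespace PCFG

variable {L : Type*} {n m : ℕ}

/-- The polynomial `f(x^out)` in the program variables. -/
noncomputable def liftOut (C : PCFG L n m) (f : MvPolynomial (Fin m) ℝ) :
    MvPolynomial (Fin n) ℝ :=
  MvPolynomial.rename (Fin.castLE C.out_le) f

/-- Symbolic form of `∑ ℓ', Pr(ℓ') · 𝔼[η(ℓ', N) + f(N^out)] - f(x^out)`. -/
noncomputable def symDrift [Fintype L] (C : PCFG L n m) (η : L → MvPolynomial (Fin n) ℝ)
    (f : MvPolynomial (Fin m) ℝ) (τ : Fin C.numTrans) : MvPolynomial (Fin n) ℝ :=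
  ∑ ℓ', MvPolynomial.C (C.prob τ ℓ').toReal * (C.update τ).symExp (η ℓ' + C.liftOut f)
    - C.liftOut f

/-- Encoding of the constraint "zero on output". -/
def ZeroConstraint (C : PCFG L n m) (K : ℕ) (I : L → PolyPred n)
    (η : L → MvPolynomial (Fin n) ℝ) : Prop :=
  (I C.lOut).Encodes K (η C.lOut) ∧ (I C.lOut).Encodes K (-η C.lOut)

/-- Encoding of the constraint "expected `f`-decrease". -/
def DecreaseConstraint [Fintype L] (C : PCFG L n m) (K : ℕ) (I : L → PolyPred n)
    (f : MvPolynomial (Fin m) ℝ) (U : L → MvPolynomial (Fin n) ℝ) : Prop :=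
  ∀ τ, ((I (C.src τ)).and (C.guard τ)).Encodes K (U (C.src τ) - C.symDrift U f τ)

/-- Encoding of the constraint "expected `f`-increase". -/
def IncreaseConstraint [Fintype L] (C : PCFG L n m) (K : ℕ) (I : L → PolyPred n)
    (f : MvPolynomial (Fin m) ℝ) (V : L → MvPolynomial (Fin n) ℝ) : Prop :=
  ∀ τ, ((I (C.src τ)).and (C.guard τ)).Encodes K (C.symDrift V f τ - V (C.src τ))

/-- The one-step change `(η(ℓ, x) + f(x^out)) - (η(ℓ', N) + f(N^out))`, `N = Next(τ, x)`, of the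
transition `τ` from `ℓ`, as a polynomial in `x` and the sampled value. -/
noncomputable def symChange (C : PCFG L n m) (η : L → MvPolynomial (Fin n) ℝ)
    (f : MvPolynomial (Fin m) ℝ) (τ : Fin C.numTrans) (ℓ' : L) :
    MvPolynomial (Option (Fin n)) ℝ :=
  MvPolynomial.rename some (η (C.src τ) + C.liftOut f)
    - MvPolynomial.bind₁ (C.update τ).symNext (η ℓ' + C.liftOut f)

/-- Encoding of the constraint that an optional-stopping condition puts on a state function `η`
and on `f`, with constant `c`: boundedness for `C2`, bounded one-step change for `C3`. -/
def OSTConstraint (C : PCFG L n m) (K : ℕ) (I : L → PolyPred n) (f : MvPolynomial (Fin m) ℝ)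
    (η : L → MvPolynomial (Fin n) ℝ) (c : ℝ) : OSTMode → Prop
  | .C1 => True
  | .C2 => ∀ ℓ, (I ℓ).Encodes K (MvPolynomial.C c - (η ℓ + C.liftOut f)) ∧
      (I ℓ).Encodes K (MvPolynomial.C c + (η ℓ + C.liftOut f))
  | .C3 => ∀ τ ℓ', C.prob τ ℓ' ≠ 0 → ∀ D ∈ ((I (C.src τ)).and (C.guard τ)).dnf true,
      Handelman K (MvPolynomial.rename some '' {h | h ∈ D} ∪ (C.update τ).supportIneqs)
        (MvPolynomial.C c - C.symChange η f τ ℓ') ∧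
      Handelman K (MvPolynomial.rename some '' {h | h ∈ D} ∪ (C.update τ).supportIneqs)
        (MvPolynomial.C c + C.symChange η f τ ℓ')
  | .C4 => True

end PCFG

/-- Variables of the Lipschitz constraints: two valuations `x`, `y`, bounds `a` on the differences
of their output components, and one bound `A`. -/
inductive LipVar (n₁ n₂ m : ℕ) : Type
  | x (i : Fin n₁) : LipVar n₁ n₂ m
  | y (i : Fin n₂) : LipVar n₁ n₂ m
  | a (i : Fin m) : LipVar n₁ n₂ m
  | A : LipVar n₁ n₂ m

namespace LipVar

variable {L₁ L₂ : Type*} {n₁ n₂ m : ℕ}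

/-- The inequalities `x_j - y_j ≤ a_j` and `y_j - x_j ≤ a_j` for the output variables. -/
def diffIneqs (C₁ : PCFG L₁ n₁ m) (C₂ : PCFG L₂ n₂ m) :
    Set (MvPolynomial (LipVar n₁ n₂ m) ℝ) :=
  {h | ∃ j : Fin m,
    h = MvPolynomial.X (a j) - (MvPolynomial.X (x (Fin.castLE C₁.out_le j))
        - MvPolynomial.X (y (Fin.castLE C₂.out_le j))) ∨
    h = MvPolynomial.X (a j) - (MvPolynomial.X (y (Fin.castLE C₂.out_le j))
        - MvPolynomial.X (x (Fin.castLE C₁.out_le j)))}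

/-- The inequalities `a_j ≤ A`. -/
def maxIneqs : Set (MvPolynomial (LipVar n₁ n₂ m) ℝ) :=
  {h | ∃ j : Fin m, h = MvPolynomial.X A - MvPolynomial.X (a j)}

/-- The difference `f(x^out) - f(y^out)`. -/
noncomputable def diff (C₁ : PCFG L₁ n₁ m) (C₂ : PCFG L₂ n₂ m) (f : MvPolynomial (Fin m) ℝ) :
    MvPolynomial (LipVar n₁ n₂ m) ℝ :=
  MvPolynomial.rename x (C₁.liftOut f) - MvPolynomial.rename y (C₂.liftOut f)

/-- Encoding of the 1-Lipschitz constraint on `f` for one clause `Γ` of the invariants: for `L^p`,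
`(f(x^out) - f(y^out))^p ≤ ∑ j, a_j^p` under the inequalities `|x_j - y_j| ≤ a_j`; for the discrete
metric, `f(x^out) - f(y^out) ≤ 1`; for the uniform metric, `f(x^out) - f(y^out) ≤ A` under the
inequalities `|x_j - y_j| ≤ a_j ≤ A`. -/
def Clause (K : ℕ) (C₁ : PCFG L₁ n₁ m) (C₂ : PCFG L₂ n₂ m) (f : MvPolynomial (Fin m) ℝ)
    (Γ : Set (MvPolynomial (LipVar n₁ n₂ m) ℝ)) : OutMetric → Prop
  | .lp p _ => Handelman K (Γ ∪ diffIneqs C₁ C₂)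
      (∑ j, MvPolynomial.X (a j) ^ p - diff C₁ C₂ f ^ p)
  | .discrete => Handelman K Γ (1 - diff C₁ C₂ f)
  | .uniform => Handelman K (Γ ∪ diffIneqs C₁ C₂ ∪ maxIneqs) (MvPolynomial.X A - diff C₁ C₂ f)

end LipVar

/-- Encoding of the constraint that `f` is 1-Lipschitz between the outputs `x^out`, `x ⊨ I₁(ℓ_out)`,
of one program and the outputs `y^out`, `y ⊨ I₂(ℓ_out)`, of a possibly different one. -/
def LipConstraint {L₁ L₂ : Type*} {n₁ n₂ m : ℕ} (K : ℕ) (C₁ : PCFG L₁ n₁ m) (C₂ : PCFG L₂ n₂ m)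
    (I₁ : L₁ → PolyPred n₁) (I₂ : L₂ → PolyPred n₂) (f : MvPolynomial (Fin m) ℝ)
    (d : OutMetric) : Prop :=
  ∀ D₁ ∈ (I₁ C₁.lOut).dnf true, ∀ D₂ ∈ (I₂ C₂.lOut).dnf true,
    LipVar.Clause K C₁ C₂ f
      (MvPolynomial.rename LipVar.x '' {h | h ∈ D₁} ∪ MvPolynomial.rename LipVar.y '' {h | h ∈ D₂})
      d

/-- The similarity refutation algorithm, run on the programs `C₁`, `C₂` with supporting invariants
`I₁`, `I₂`, template degree `deg`, encoding degree `K`, optional-stopping condition `mode`, metric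
`d` and bound `ε`, may answer "Not `ε`-output close" and output `f`, `U`, `V`: these instantiate
the templates and solve, together with some values of the auxiliary unknowns, the system of
encoded constraints. -/
structure AnswersNotClose {L₁ L₂ : Type*} [Fintype L₁] [Fintype L₂] {n₁ n₂ m : ℕ}
    (C₁ : PCFG L₁ n₁ m) (C₂ : PCFG L₂ n₂ m) (I₁ : L₁ → PolyPred n₁) (I₂ : L₂ → PolyPred n₂)
    (deg K : ℕ) (mode : OSTMode) (d : OutMetric) (ε : ℝ) (f : MvPolynomial (Fin m) ℝ)
    (U : L₁ → MvPolynomial (Fin n₁) ℝ) (V : L₂ → MvPolynomial (Fin n₂) ℝ) : Prop where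
  degree_f : f.totalDegree ≤ deg
  degree_U : ∀ ℓ, (U ℓ).totalDegree ≤ deg
  degree_V : ∀ ℓ, (V ℓ).totalDegree ≤ deg
  zero_U : C₁.ZeroConstraint K I₁ U
  decrease_U : C₁.DecreaseConstraint K I₁ f U
  zero_V : C₂.ZeroConstraint K I₂ V
  increase_V : C₂.IncreaseConstraint K I₂ f V
  ost : ∃ c : ℝ, 0 < c ∧ C₁.OSTConstraint K I₁ f U c mode ∧ C₂.OSTConstraint K I₂ f V c mode
  similarity : ε ≤ (MvPolynomial.eval C₂.xInit (V C₂.lInit) + MvPolynomial.eval (C₂.out C₂.xInit) f)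
    - (MvPolynomial.eval C₁.xInit (U C₁.lInit) + MvPolynomial.eval (C₁.out C₁.xInit) f)
  lipschitz₁₁ : LipConstraint K C₁ C₁ I₁ I₁ f d
  lipschitz₂₂ : LipConstraint K C₂ C₂ I₂ I₂ f d
  lipschitz₁₂ : LipConstraint K C₁ C₂ I₁ I₂ f d
  lipschitz₂₁ : LipConstraint K C₂ C₁ I₂ I₁ f d

/-- The output distributions of `C₁` and `C₂` are `ε`-output close. -/
def OutputClose {L₁ L₂ : Type*} [MeasurableSpace L₁] [DiscreteMeasurableSpace L₁]
    [MeasurableSpace L₂] [DiscreteMeasurableSpace L₂] {n₁ n₂ m : ℕ}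
    (C₁ : PCFG L₁ n₁ m) (C₂ : PCFG L₂ n₂ m) (d : OutMetric) (ε : ℝ) : Prop :=
  kantorovich d.d C₁.outputLaw C₂.outputLaw < ENNReal.ofReal ε

/-! ### Soundness of the polynomial encodings -/

/-! Only soundness of the encodings is needed. A Handelman certificate is manifestly nonnegative
wherever its premises are (`Handelman.eval_nonneg`), and relaxing strict inequalities in the normal
form only weakens premises (`exists_mem_dnf`). Hence every encoded constraint holds pointwise. As
the symbolic expectations equal the true ones (`FiniteMoments.integral_eval`), `U` is a UESM and `V`
an LESM.

The potential `η(ℓ, x) + f(x^out)` is then a super- or submartingale along the run. Finite moments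
make polynomials integrable at each fixed time, and almost every run follows `Succ`, hence stays
inside the invariant (`ae_isRun`). So the expected potential after `k` steps is at most (for `V`: at
least) its initial value (`integral_eval_run_le`).

On a terminating run the potential is eventually constant and equal to `f` of the output, because
`η` vanishes on the invariant at the terminal location. To let `k → ∞`, each of the conditions C1–C4
supplies one integrable function dominating the potential at all times (`exists_integrable_bound`);
dominated convergence then plays the role of optional stopping. Thus `𝔼[f]` under the first output
law is at most the initial value of `U + f`, under the second at least that of `V + f`, and the two
differ by at least `ε`.

The polynomial `f` is 1-Lipschitz only on the allowed outputs, while the Kantorovich distance ranges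
over functions that are 1-Lipschitz everywhere. `OutMetric.exists_extension` replaces `f` by a
globally 1-Lipschitz measurable `g` that agrees with it on these outputs, which carry both laws; `g`
is the witness for the supremum. -/

theorem MvPolynomial.eval_bind₁ {σ τ : Type*} (y : τ → ℝ) (s : σ → MvPolynomial τ ℝ)
    (p : MvPolynomial σ ℝ) :
    eval y (bind₁ s p) = eval (fun i => eval y (s i)) p := by
  have := aeval_bind₁ (S := ℝ) y s p
  simpa [coe_aeval_eq_eval] using this

theorem Handelman.eval_nonneg {σ : Type*} {K : ℕ} {Γ : Set (MvPolynomial σ ℝ)}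
    {g : MvPolynomial σ ℝ} (hg : Handelman K Γ g) {x : σ → ℝ}
    (hx : ∀ h ∈ Γ, 0 ≤ MvPolynomial.eval x h) : 0 ≤ MvPolynomial.eval x g := by
  refine Submodule.span_induction (p := fun q _ => 0 ≤ MvPolynomial.eval x q) ?_ ?_ ?_ ?_ hg
  · rintro q ⟨s, -, hs, rfl⟩
    rw [map_multiset_prod]
    refine Multiset.prod_nonneg fun a ha => ?_
    obtain ⟨h, hh, rfl⟩ := Multiset.mem_map.1 ha
    exact hx h (hs h hh)
  · simp
  · intro p q _ _ hp hq
    simpa using add_nonneg hp hq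
  · intro a p _ hp
    have : MvPolynomial.eval x (a • p) = (a : ℝ) * MvPolynomial.eval x p := by
      rw [NNReal.smul_def, MvPolynomial.smul_eval]
    rw [this]
    exact mul_nonneg a.2 hp

namespace PolyPred

variable {n : ℕ}

/-- Negation exchanges the two polarities of `dnf`, so the induction must treat both at once. The
converse fails because strict inequalities are relaxed, but soundness needs only this direction. -/
theorem exists_mem_dnf (P : PolyPred n) (x : Fin n → ℝ) :
    (P.Holds x → ∃ D ∈ P.dnf true, ∀ h ∈ D, 0 ≤ MvPolynomial.eval x h) ∧
    (¬ P.Holds x → ∃ D ∈ P.dnf false, ∀ h ∈ D, 0 ≤ MvPolynomial.eval x h) := by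
  induction P with
  | le p q =>
    simp only [Holds, dnf]
    refine ⟨fun h => ⟨_, List.mem_singleton_self _, by simpa using h⟩,
      fun h => ⟨_, List.mem_singleton_self _, ?_⟩⟩
    simpa using (not_le.1 h).le
  | and P Q hP hQ =>
    simp only [Holds, dnf, List.mem_flatMap, List.mem_map, List.mem_append]
    refine ⟨fun h => ?_, fun h => ?_⟩
    · obtain ⟨D, hD, hD'⟩ := hP.1 h.1
      obtain ⟨E, hE, hE'⟩ := hQ.1 h.2
      refine ⟨D ++ E, ⟨D, hD, E, hE, rfl⟩, fun g hg => ?_⟩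
      exact (List.mem_append.1 hg).elim (hD' g) (hE' g)
    · rcases not_and_or.1 h with h | h
      · obtain ⟨D, hD, hD'⟩ := hP.2 h
        exact ⟨D, Or.inl hD, hD'⟩
      · obtain ⟨D, hD, hD'⟩ := hQ.2 h
        exact ⟨D, Or.inr hD, hD'⟩
  | or P Q hP hQ =>
    simp only [Holds, dnf, List.mem_flatMap, List.mem_map, List.mem_append]
    refine ⟨fun h => ?_, fun h => ?_⟩
    · rcases h with h | h
      · obtain ⟨D, hD, hD'⟩ := hP.1 h
        exact ⟨D, Or.inl hD, hD'⟩
      · obtain ⟨D, hD, hD'⟩ := hQ.1 h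
        exact ⟨D, Or.inr hD, hD'⟩
    · obtain ⟨h₁, h₂⟩ := not_or.1 h
      obtain ⟨D, hD, hD'⟩ := hP.2 h₁
      obtain ⟨E, hE, hE'⟩ := hQ.2 h₂
      refine ⟨D ++ E, ⟨D, hD, E, hE, rfl⟩, fun g hg => ?_⟩
      exact (List.mem_append.1 hg).elim (hD' g) (hE' g)
  | not P hP =>
    simp only [Holds, dnf, not_not]
    exact ⟨hP.2, hP.1⟩

theorem Holds.exists_mem_dnf {P : PolyPred n} {x : Fin n → ℝ} (h : P.Holds x) :
    ∃ D ∈ P.dnf true, ∀ h ∈ D, 0 ≤ MvPolynomial.eval x h :=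
  (P.exists_mem_dnf x).1 h

theorem Encodes.eval_nonneg {K : ℕ} {P : PolyPred n} {g : MvPolynomial (Fin n) ℝ}
    (hg : P.Encodes K g) {x : Fin n → ℝ} (hx : P.Holds x) : 0 ≤ MvPolynomial.eval x g := by
  obtain ⟨D, hD, hD'⟩ := hx.exists_mem_dnf
  exact (hg D hD).eval_nonneg hD'

end PolyPred

/-! ### Expectations and possible values of a single update -/

namespace VarUpdate

variable {n : ℕ}

theorem next_skip_apply (x : Fin n → ℝ) : (skip : VarUpdate n).next x = Measure.dirac x := by
  simp [next, Kernel.id_apply]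

theorem next_assign_apply (j : Fin n) (p : MvPolynomial (Fin n) ℝ) (x : Fin n → ℝ) :
    (assign j p).next x = Measure.dirac (Function.update x j (MvPolynomial.eval x p)) := by
  simp [next, Kernel.deterministic_apply]

theorem next_sample_apply (j : Fin n) (δ : ProbabilityMeasure ℝ) (x : Fin n → ℝ) :
    (sample j δ).next x = (δ : Measure ℝ).map fun v => Function.update x j v := by
  rw [next, Kernel.map_apply _ (measurable_sample j), Kernel.prod_apply, Kernel.id_apply,
    Kernel.const_apply, Measure.dirac_prod, Measure.map_map (measurable_sample j) (by fun_prop)]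
  rfl

theorem measurable_update_apply (j : Fin n) (x : Fin n → ℝ) :
    Measurable fun v : ℝ => Function.update x j v :=
  (measurable_sample j).comp (measurable_const.prodMk measurable_id)

/-- Separating the power of the updated variable from the rest of each monomial reduces integration
over a sampled value to moments. -/
theorem eval_update (j : Fin n) (x : Fin n → ℝ) (p : MvPolynomial (Fin n) ℝ) (v : ℝ) :
    MvPolynomial.eval (Function.update x j v) p =
      ∑ α ∈ p.support, v ^ α j * MvPolynomial.eval x
        (MvPolynomial.monomial (α.erase j) (p.coeff α)) := by
  rw [MvPolynomial.eval_eq']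
  refine Finset.sum_congr rfl fun α _ => ?_
  rw [MvPolynomial.eval_monomial, Finsupp.prod_fintype _ _ (by simp),
    ← Finset.mul_prod_erase _ _ (Finset.mem_univ j), ← Finset.mul_prod_erase _ _ (Finset.mem_univ j)]
  have : ∀ i ∈ Finset.univ.erase j, Function.update x j v i ^ α i = x i ^ (α.erase j) i := by
    intro i hi
    have hij := Finset.ne_of_mem_erase hi
    rw [Function.update_of_ne hij, Finsupp.erase_ne hij]
  rw [Finset.prod_congr rfl this]
  simp
  ring

theorem FiniteMoments.integrable_pow {j : Fin n} {δ : ProbabilityMeasure ℝ}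
    (h : (sample j δ).FiniteMoments) (k : ℕ) : Integrable (fun v => v ^ k) (δ : Measure ℝ) := by
  refine (h k).mono' (by fun_prop) (.of_forall fun v => ?_)
  simp

theorem FiniteMoments.integrable_eval {u : VarUpdate n} (hu : u.FiniteMoments)
    (p : MvPolynomial (Fin n) ℝ) (x : Fin n → ℝ) :
    Integrable (fun N => MvPolynomial.eval N p) (u.next x) := by
  cases u with
  | skip => rw [next_skip_apply]; exact integrable_dirac (by finiteness)
  | assign j q => rw [next_assign_apply]; exact integrable_dirac (by finiteness)
  | sample j δ =>
    rw [next_sample_apply, integrable_map_measure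
      (MvPolynomial.continuous_eval p).aestronglyMeasurable
      (measurable_update_apply j x).aemeasurable]
    simp only [Function.comp_def, eval_update]
    exact integrable_finsetSum _ fun α _ => (hu.integrable_pow _).mul_const _

theorem FiniteMoments.integral_eval {u : VarUpdate n} (hu : u.FiniteMoments)
    (p : MvPolynomial (Fin n) ℝ) (x : Fin n → ℝ) :
    ∫ N, MvPolynomial.eval N p ∂u.next x = MvPolynomial.eval x (u.symExp p) := by
  cases u with
  | skip => rw [next_skip_apply, integral_dirac]; rfl
  | assign j q =>
    rw [next_assign_apply, integral_dirac, symExp, MvPolynomial.eval_bind₁]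
    congr 2
    funext i
    by_cases h : i = j
    · subst h; simp
    · simp [Function.update_of_ne h]
  | sample j δ =>
    rw [next_sample_apply, integral_map (measurable_update_apply j x).aemeasurable
      (MvPolynomial.continuous_eval p).aestronglyMeasurable]
    simp only [eval_update, symExp, map_sum]
    rw [integral_finsetSum _ fun α _ => (hu.integrable_pow _).mul_const _]
    refine Finset.sum_congr rfl fun α _ => ?_
    rw [integral_mul_const, MvPolynomial.eval_monomial, MvPolynomial.eval_monomial]
    ring

theorem ae_mem_nextSupport (u : VarUpdate n) (x : Fin n → ℝ) :
    ∀ᵐ N ∂u.next x, N ∈ u.nextSupport x := by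
  cases u with
  | skip => rw [next_skip_apply]; simp [nextSupport]
  | assign j q => rw [next_assign_apply]; simp [nextSupport]
  | sample j δ =>
    rw [next_sample_apply]
    have h : ∀ᵐ v ∂(δ : Measure ℝ), v ∈ (δ : Measure ℝ).support := Measure.support_mem_ae
    -- Updating one coordinate is injective, so the almost-everywhere statement can be pulled back
    -- without first proving that the image of the support is measurable.
    have hm : MeasurableEmbedding fun v : ℝ => Function.update x j v :=
      (measurable_update_apply j x).measurableEmbedding (Function.update_injective x j)
    rw [hm.ae_map_iff]
    filter_upwards [h] with v hv
    exact ⟨v, hv, rfl⟩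

theorem measurableSet_nextSupport (u : VarUpdate n) :
    MeasurableSet {z : (Fin n → ℝ) × (Fin n → ℝ) | z.2 ∈ u.nextSupport z.1} := by
  cases u with
  | skip => exact measurableSet_eq_fun measurable_snd measurable_fst
  | assign j q =>
    exact measurableSet_eq_fun measurable_snd ((measurable_assign j q).comp measurable_fst)
  | sample j δ =>
    -- The image is rewritten through preimages: the sampled value can be recovered as coordinate
    -- `j` of the successor.
    have h : {z : (Fin n → ℝ) × (Fin n → ℝ) | z.2 ∈ (sample j δ).nextSupport z.1} =
        {z | z.2 j ∈ (δ : Measure ℝ).support} ∩ {z | Function.update z.1 j (z.2 j) = z.2} := by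
      ext ⟨x, y⟩
      simp only [nextSupport, Set.mem_image, Set.mem_ofPred_eq, Set.mem_inter_iff]
      constructor
      · rintro ⟨v, hv, rfl⟩
        simp [hv]
      · rintro ⟨h₁, h₂⟩
        exact ⟨_, h₁, h₂⟩
    rw [h]
    refine MeasurableSet.inter ?_ (measurableSet_eq_fun ?_ measurable_snd)
    · exact ((measurable_pi_apply j).comp measurable_snd) Measure.isClosed_support.measurableSet
    · exact (measurable_sample j).comp
        (measurable_fst.prodMk ((measurable_pi_apply j).comp measurable_snd))

/-- A possible successor valuation is the value of `symNext` at a sampled value in the support. -/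
theorem exists_eval_symNext {u : VarUpdate n} {x y : Fin n → ℝ} (hy : y ∈ u.nextSupport x) :
    ∃ v : ℝ, (∀ g ∈ u.supportIneqs,
        0 ≤ MvPolynomial.eval (fun o : Option (Fin n) => o.elim v x) g) ∧
      (fun i => MvPolynomial.eval (fun o : Option (Fin n) => o.elim v x) (u.symNext i)) = y := by
  cases u with
  | skip =>
    -- Nothing is sampled, so the value of the extra variable is irrelevant.
    refine ⟨0, by simp [supportIneqs], ?_⟩
    obtain rfl : y = x := hy
    funext i
    simp [symNext]
  | assign j q =>
    refine ⟨0, by simp [supportIneqs], ?_⟩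
    obtain rfl : y = _ := hy
    funext i
    by_cases h : i = j
    · subst h
      simp [symNext, MvPolynomial.eval_rename, Function.comp_def]
    · simp [symNext, Function.update_of_ne h]
  | sample j δ =>
    obtain ⟨v, hv, rfl⟩ := hy
    refine ⟨v, ?_, ?_⟩
    · rintro g ⟨a, b, hab, rfl⟩
      simpa using hab v hv
    · funext i
      by_cases h : i = j
      · subst h
        simp [symNext]
      · simp [symNext, Function.update_of_ne h]

end VarUpdate

/-! ### From solved constraints to martingale inequalities -/

namespace PCFG

variable {L : Type*} {n m : ℕ}

theorem eval_liftOut (C : PCFG L n m) (f : MvPolynomial (Fin m) ℝ) (x : Fin n → ℝ) :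
    MvPolynomial.eval x (C.liftOut f) = MvPolynomial.eval (C.out x) f := by
  rw [liftOut, MvPolynomial.eval_rename]
  rfl

/-- The polynomial `η(ℓ, x) + f(x^out)`. -/
noncomputable def potential (C : PCFG L n m) (η : L → MvPolynomial (Fin n) ℝ)
    (f : MvPolynomial (Fin m) ℝ) (ℓ : L) : MvPolynomial (Fin n) ℝ :=
  η ℓ + C.liftOut f

theorem eval_potential (C : PCFG L n m) (η : L → MvPolynomial (Fin n) ℝ)
    (f : MvPolynomial (Fin m) ℝ) (ℓ : L) (x : Fin n → ℝ) :
    MvPolynomial.eval x (C.potential η f ℓ) =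
      MvPolynomial.eval x (η ℓ) + MvPolynomial.eval (C.out x) f := by
  rw [potential, map_add, eval_liftOut]

theorem nextExp_eq_eval_symDrift [Fintype L] [MeasurableSpace L] [DiscreteMeasurableSpace L]
    (C : PCFG L n m) (hC : C.FiniteMoments) (η : L → MvPolynomial (Fin n) ℝ)
    (f : MvPolynomial (Fin m) ℝ) (τ : Fin C.numTrans) (x : Fin n → ℝ) :
    C.nextExp (fun ℓ x => MvPolynomial.eval x (η ℓ)) (fun x => MvPolynomial.eval x f) τ x
      - MvPolynomial.eval (C.out x) f = MvPolynomial.eval x (C.symDrift η f τ) := by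
  rw [nextExp, symDrift, map_sub, eval_liftOut, map_sum]
  congr 1
  refine Finset.sum_congr rfl fun ℓ' _ => ?_
  rw [map_mul, MvPolynomial.eval_C, ← (hC τ).integral_eval]
  simp only [map_add, eval_liftOut]

section Soundness

variable {C : PCFG L n m} {K : ℕ} {I : L → PolyPred n} {f : MvPolynomial (Fin m) ℝ} {η : L → MvPolynomial (Fin n) ℝ}

theorem ZeroConstraint.eval_eq_zero (h : C.ZeroConstraint K I η) {x : Fin n → ℝ}
    (hx : (I C.lOut).Holds x) : MvPolynomial.eval x (η C.lOut) = 0 := by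
  have h₁ := h.1.eval_nonneg hx
  have h₂ := h.2.eval_nonneg hx
  rw [map_neg] at h₂
  linarith

theorem integrable_eval_next (hC : C.FiniteMoments) (η : L → MvPolynomial (Fin n) ℝ)
    (f : MvPolynomial (Fin m) ℝ) (τ : Fin C.numTrans) (x : Fin n → ℝ) (ℓ' : L) :
    Integrable (fun N => MvPolynomial.eval N (η ℓ') + MvPolynomial.eval (C.out N) f)
      ((C.update τ).next x) := by
  simpa only [eval_potential] using (hC τ).integrable_eval (C.potential η f ℓ') x

theorem isUESM_of_constraints [Fintype L] [MeasurableSpace L]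
    [DiscreteMeasurableSpace L] (hC : C.FiniteMoments) (hterm : C.TerminatesAS)
    (hinv : C.IsInvariant I) (hzero : C.ZeroConstraint K I η)
    (hdec : C.DecreaseConstraint K I f η) :
    C.IsUESM I (fun x => MvPolynomial.eval x f) (fun ℓ x => MvPolynomial.eval x (η ℓ)) where
  terminates := hterm
  invariant := hinv
  measurable_f := (MvPolynomial.continuous_eval f).measurable
  measurable ℓ := (MvPolynomial.continuous_eval (η ℓ)).measurable
  zero_on_output _ hx := hzero.eval_eq_zero hx
  integrable τ x _ _ ℓ' _ := integrable_eval_next hC η f τ x ℓ'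
  decrease τ x hI hG := by
    have := (hdec τ).eval_nonneg (x := x) ⟨hI, hG⟩
    rw [map_sub, ← nextExp_eq_eval_symDrift C hC] at this
    linarith

theorem isLESM_of_constraints [Fintype L] [MeasurableSpace L]
    [DiscreteMeasurableSpace L] (hC : C.FiniteMoments) (hterm : C.TerminatesAS)
    (hinv : C.IsInvariant I) (hzero : C.ZeroConstraint K I η)
    (hinc : C.IncreaseConstraint K I f η) :
    C.IsLESM I (fun x => MvPolynomial.eval x f) (fun ℓ x => MvPolynomial.eval x (η ℓ)) where
  terminates := hterm
  invariant := hinv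
  measurable_f := (MvPolynomial.continuous_eval f).measurable
  measurable ℓ := (MvPolynomial.continuous_eval (η ℓ)).measurable
  zero_on_output _ hx := hzero.eval_eq_zero hx
  integrable τ x _ _ ℓ' _ := integrable_eval_next hC η f τ x ℓ'
  increase τ x hI hG := by
    have := (hinc τ).eval_nonneg (x := x) ⟨hI, hG⟩
    rw [map_sub, ← nextExp_eq_eval_symDrift C hC] at this
    linarith

theorem OSTConstraint.abs_potential_le {c : ℝ} (h : C.OSTConstraint K I f η c .C2) {ℓ : L}
    {x : Fin n → ℝ} (hx : (I ℓ).Holds x) :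
    |MvPolynomial.eval x (C.potential η f ℓ)| ≤ c := by
  have h₁ := (h ℓ).1.eval_nonneg hx
  have h₂ := (h ℓ).2.eval_nonneg hx
  rw [map_sub, MvPolynomial.eval_C] at h₁
  rw [map_add, MvPolynomial.eval_C] at h₂
  rw [potential, abs_le]
  constructor <;> linarith

/-- The certificate treats the sampled value as one more variable. A successor determines a concrete
value satisfying the support inequalities, and the certificate is evaluated there. -/
theorem OSTConstraint.abs_potential_sub_le {c : ℝ} (h : C.OSTConstraint K I f η c .C3)
    {s s' : L × (Fin n → ℝ)} (hs : (I s.1).Holds s.2) (hss : C.Succ s s') :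
    |MvPolynomial.eval s'.2 (C.potential η f s'.1) - MvPolynomial.eval s.2 (C.potential η f s.1)|
      ≤ c := by
  obtain ⟨τ, ⟨hsrc, hG⟩, hp, hsupp⟩ := hss
  have hI : ((I (C.src τ)).and (C.guard τ)).Holds s.2 := ⟨hsrc ▸ hs, hG⟩
  obtain ⟨D, hD, hD'⟩ := hI.exists_mem_dnf
  obtain ⟨v, hv, hy⟩ := VarUpdate.exists_eval_symNext hsupp
  have hΓ : ∀ g ∈ MvPolynomial.rename some '' {h | h ∈ D} ∪ (C.update τ).supportIneqs,
      0 ≤ MvPolynomial.eval (fun o : Option (Fin n) => o.elim v s.2) g := by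
    rintro g (⟨g, hg, rfl⟩ | hg)
    · simpa [MvPolynomial.eval_rename, Function.comp_def] using hD' g hg
    · exact hv g hg
  have hch : MvPolynomial.eval (fun o : Option (Fin n) => o.elim v s.2)
      (C.symChange η f τ s'.1) = MvPolynomial.eval s.2 (C.potential η f s.1)
        - MvPolynomial.eval s'.2 (C.potential η f s'.1) := by
    rw [symChange, map_sub, MvPolynomial.eval_bind₁, hy, hsrc]
    simp [MvPolynomial.eval_rename, Function.comp_def, potential]
  obtain ⟨h₁, h₂⟩ := h τ s'.1 hp D hD
  replace h₁ := h₁.eval_nonneg hΓ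
  replace h₂ := h₂.eval_nonneg hΓ
  rw [map_sub, MvPolynomial.eval_C, hch] at h₁
  rw [map_add, MvPolynomial.eval_C, hch] at h₂
  rw [abs_le]
  constructor <;> linarith

end Soundness

end PCFG

namespace PCFG

variable {L : Type*} {n m : ℕ}

/-! ### Runs -/

/-- `ρ` starts in the initial state and proceeds along successors. -/
def IsRun (C : PCFG L n m) (ρ : ℕ → L × (Fin n → ℝ)) : Prop :=
  ρ 0 = (C.lInit, C.xInit) ∧ ∀ k, C.Succ (ρ k) (ρ (k + 1))

theorem Succ.eq_of_fst_eq_lOut {C : PCFG L n m} {s s' : L × (Fin n → ℝ)} (h : C.Succ s s')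
    (hs : s.1 = C.lOut) : s' = s := by
  obtain ⟨τ₀, hsrc, hprob, -, hupd⟩ := C.terminal
  obtain ⟨τ, ⟨hτ, -⟩, hp, hsupp⟩ := h
  obtain rfl := (hsrc τ).1 (hτ.trans hs)
  rw [hprob, PMF.pure_apply] at hp
  have h₁ : s'.1 = C.lOut := by
    by_contra hne
    exact hp (if_neg hne)
  rw [hupd] at hsupp
  exact Prod.ext (h₁.trans hs.symm) hsupp

namespace IsRun

variable {C : PCFG L n m} {ρ : ℕ → L × (Fin n → ℝ)}

theorem reachable (h : C.IsRun ρ) (k : ℕ) : C.Reachable (ρ k) := by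
  induction k with
  | zero => rw [h.1]; exact Relation.ReflTransGen.refl
  | succ k ih => exact Relation.ReflTransGen.tail ih (h.2 k)

theorem eq_of_le (h : C.IsRun ρ) {j k : ℕ} (hj : (ρ j).1 = C.lOut) (hjk : j ≤ k) :
    ρ k = ρ j := by
  induction k, hjk using Nat.le_induction with
  | base => rfl
  | succ k _ ih => rw [(h.2 k).eq_of_fst_eq_lOut (by rw [ih, hj]), ih]

theorem termTime_le_iff (h : C.IsRun ρ) (k : ℕ) : C.termTime ρ ≤ k ↔ (ρ k).1 = C.lOut := by
  constructor
  · intro hk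
    -- A strict upper bound on the infimum yields an actual hitting index below it.
    have hlt : C.termTime ρ < ((k + 1 : ℕ) : ℕ∞) :=
      hk.trans_lt (by exact_mod_cast Nat.lt_succ_self k)
    rw [termTime, iInf_lt_iff] at hlt
    obtain ⟨i, hi⟩ := hlt
    rw [iInf_lt_iff] at hi
    obtain ⟨hi, hik⟩ := hi
    have hik : i ≤ k := Nat.lt_succ_iff.1 (by exact_mod_cast hik)
    rw [h.eq_of_le hi hik, hi]
  · intro hk
    exact iInf₂_le k hk

theorem runOut_eq (h : C.IsRun ρ) {k : ℕ} (hk : (ρ k).1 = C.lOut) :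
    C.runOut ρ = C.out (ρ k).2 := by
  have hne : {i | (ρ i).1 = C.lOut}.Nonempty := ⟨k, hk⟩
  rw [runOut, h.eq_of_le (Nat.sInf_mem hne) (Nat.sInf_le hk)]

end IsRun

/-! ### The law of the run: Markov property, integrability, monotone expectations -/

section RunLaw

variable [MeasurableSpace L] [DiscreteMeasurableSpace L]

instance isProbabilityMeasure_runLaw (C : PCFG L n m) : IsProbabilityMeasure C.runLaw := by
  rw [runLaw]
  infer_instance

/-- The law of the state after `k` steps. -/
noncomputable def stateLaw (C : PCFG L n m) (k : ℕ) : Measure (L × (Fin n → ℝ)) :=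
  C.runLaw.map fun ρ => ρ k

instance isProbabilityMeasure_stateLaw (C : PCFG L n m) (k : ℕ) :
    IsProbabilityMeasure (C.stateLaw k) :=
  Measure.isProbabilityMeasure_map (measurable_pi_apply k).aemeasurable

/-- This is the Markov property. The trajectory measure describes the next state given the whole
history; since the kernel reads only the last state of the history, projecting to that state leaves
`step`. -/
theorem map_runLaw_pair (C : PCFG L n m) (k : ℕ) :
    C.runLaw.map (fun ρ => (ρ k, ρ (k + 1))) = C.stateLaw k ⊗ₘ C.step := by
  have h := Kernel.map_frestrictLe_trajMeasure_compProd_eq_map_trajMeasure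
    (X := fun _ => L × (Fin n → ℝ)) (μ₀ := Measure.dirac (C.lInit, C.xInit))
    (κ := fun k => C.step.comap (fun h => h ⟨k, Finset.mem_Iic.2 le_rfl⟩) (measurable_pi_apply _))
    (a := k)
  change C.runLaw.map _ ⊗ₘ _ = C.runLaw.map _ at h
  have hm : Measurable fun z : (Finset.Iic k → L × (Fin n → ℝ)) × (L × (Fin n → ℝ)) =>
      (z.1 ⟨k, Finset.mem_Iic.2 le_rfl⟩, z.2) := by fun_prop
  have h' := congrArg (Measure.map fun z : (Finset.Iic k → L × (Fin n → ℝ)) × (L × (Fin n → ℝ)) =>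
      (z.1 ⟨k, Finset.mem_Iic.2 le_rfl⟩, z.2)) h
  rw [Measure.map_map hm (by fun_prop)] at h'
  refine Eq.trans h'.symm ?_
  refine Measure.ext_of_lintegral _ fun F hF => ?_
  rw [lintegral_map hF hm, Measure.lintegral_compProd 
      (f := fun z : (Finset.Iic k → L × (Fin n → ℝ)) × (L × (Fin n → ℝ)) =>
        F (z.1 ⟨k, Finset.mem_Iic.2 le_rfl⟩, z.2)) (hF.comp hm),
    Measure.lintegral_compProd hF, stateLaw]
  have hF' : Measurable fun s => ∫⁻ s', F (s, s') ∂C.step s := hF.lintegral_kernel_prod_right'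
  rw [lintegral_map hF' (by fun_prop)]
  exact lintegral_map (f := fun h : Finset.Iic k → L × (Fin n → ℝ) =>
      ∫⁻ s', F (h ⟨k, Finset.mem_Iic.2 le_rfl⟩, s') ∂C.step (h ⟨k, Finset.mem_Iic.2 le_rfl⟩))
    (hF'.comp (measurable_pi_apply _)) (by fun_prop)

theorem stateLaw_zero (C : PCFG L n m) :
    C.stateLaw 0 = Measure.dirac (C.lInit, C.xInit) := by
  have h : (fun ρ : ℕ → L × (Fin n → ℝ) => ρ 0) =
      (fun h : Finset.Iic 0 → L × (Fin n → ℝ) => h ⟨0, Finset.mem_Iic.2 le_rfl⟩) ∘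
        Preorder.frestrictLe (π := fun _ => L × (Fin n → ℝ)) 0 := rfl
  rw [stateLaw, h, ← Measure.map_map (by fun_prop) (by fun_prop), runLaw, Kernel.trajMeasure,
    Measure.map_comp _ _ (by fun_prop), Kernel.traj_map_frestrictLe, Kernel.partialTraj_self,
    Measure.id_comp]
  refine (Measure.map_map (by fun_prop) (by fun_prop)).trans ?_
  exact Measure.map_dirac' (α := L × (Fin n → ℝ)) (by fun_prop) _

theorem measurableSet_succ (C : PCFG L n m) :
    MeasurableSet {z : (L × (Fin n → ℝ)) × (L × (Fin n → ℝ)) | C.Succ z.1 z.2} := by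
  have h : {z : (L × (Fin n → ℝ)) × (L × (Fin n → ℝ)) | C.Succ z.1 z.2} =
      ⋃ τ, ({z | C.Enabled τ z.1} ∩ {z | C.prob τ z.2.1 ≠ 0} ∩
        {z | z.2.2 ∈ (C.update τ).nextSupport z.1.2}) := by
    ext z
    simp [Succ, and_assoc]
  rw [h]
  refine MeasurableSet.iUnion fun τ => ((measurable_fst (C.measurableSet_enabled τ)).inter ?_).inter
    ((measurable_fst.snd.prodMk measurable_snd.snd) (C.update τ).measurableSet_nextSupport)
  exact measurable_snd.fst (MeasurableSet.of_discrete (s := {ℓ | C.prob τ ℓ ≠ 0}))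

theorem ae_step_succ (C : PCFG L n m) (s : L × (Fin n → ℝ)) : ∀ᵐ s' ∂C.step s, C.Succ s s' := by
  obtain ⟨τ, hτ, -⟩ := C.existsUnique_enabled s.1 s.2
  rw [C.step_apply (τ := τ) hτ]
  have h₁ : ∀ᵐ ℓ ∂(C.prob τ).toMeasure, C.prob τ ℓ ≠ 0 := by
    rw [ae_iff, PMF.toMeasure_apply_eq_zero_iff _ MeasurableSet.of_discrete]
    rw [Set.disjoint_left]
    intro ℓ h h'
    exact h' h
  have h₂ := (C.update τ).ae_mem_nextSupport s.2
  have h₁' := Measure.quasiMeasurePreserving_fst (μ := (C.prob τ).toMeasure)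
    (ν := (C.update τ).next s.2) |>.ae h₁
  have h₂' := Measure.quasiMeasurePreserving_snd (μ := (C.prob τ).toMeasure)
    (ν := (C.update τ).next s.2) |>.ae h₂
  filter_upwards [h₁', h₂'] with s' hs₁ hs₂
  exact ⟨τ, hτ, hs₁, hs₂⟩

variable [Fintype L]

/-- Bridges the measure-theoretic process and the combinatorial notion of reachability: countably
many almost sure one-step statements combine, after which invariants and absorption can be used run
by run. -/
theorem ae_isRun (C : PCFG L n m) : ∀ᵐ ρ ∂C.runLaw, C.IsRun ρ := by
  refine Filter.Eventually.and ?_ (ae_all_iff.2 fun k => ?_)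
  · have h : ∀ᵐ s ∂C.stateLaw 0, s = (C.lInit, C.xInit) := by
      rw [stateLaw_zero, ae_dirac_eq]
      rfl
    exact ae_of_ae_map (f := fun ρ : ℕ → L × (Fin n → ℝ) => ρ 0) (measurable_pi_apply 0).aemeasurable h
  · have h : ∀ᵐ z ∂C.runLaw.map (fun ρ => (ρ k, ρ (k + 1))), C.Succ z.1 z.2 := by
      rw [map_runLaw_pair]
      exact Measure.ae_compProd_of_ae_ae C.measurableSet_succ (.of_forall C.ae_step_succ)
    exact ae_of_ae_map (f := fun ρ : ℕ → L × (Fin n → ℝ) => (ρ k, ρ (k + 1))) (by fun_prop) h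

theorem measurable_of_forall_fst {g : L → (Fin n → ℝ) → ℝ} (hg : ∀ ℓ, Measurable (g ℓ)) :
    Measurable fun s : L × (Fin n → ℝ) => g s.1 s.2 :=
  measurable_from_prod_countable_right hg

theorem measurable_eval_state (p : L → MvPolynomial (Fin n) ℝ) :
    Measurable fun s : L × (Fin n → ℝ) => MvPolynomial.eval s.2 (p s.1) :=
  measurable_of_forall_fst fun ℓ => (MvPolynomial.continuous_eval (p ℓ)).measurable

theorem integrable_eval_step {C : PCFG L n m} (hC : C.FiniteMoments)
    (p : L → MvPolynomial (Fin n) ℝ) (s : L × (Fin n → ℝ)) :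
    Integrable (fun s' => MvPolynomial.eval s'.2 (p s'.1)) (C.step s) := by
  obtain ⟨τ, hτ, -⟩ := C.existsUnique_enabled s.1 s.2
  rw [C.step_apply (τ := τ) hτ, integrable_prod_iff (measurable_eval_state p).aestronglyMeasurable]
  exact ⟨.of_forall fun ℓ => (hC τ).integrable_eval (p ℓ) s.2, .of_finite⟩

theorem integral_eval_step {C : PCFG L n m} (hC : C.FiniteMoments)
    (p : L → MvPolynomial (Fin n) ℝ) {s : L × (Fin n → ℝ)} {τ : Fin C.numTrans}
    (hτ : C.Enabled τ s) :
    ∫ s', MvPolynomial.eval s'.2 (p s'.1) ∂C.step s =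
      ∑ ℓ', (C.prob τ ℓ').toReal * ∫ N, MvPolynomial.eval N (p ℓ') ∂(C.update τ).next s.2 := by
  have h := integrable_eval_step hC p s
  rw [C.step_apply hτ] at h ⊢
  rw [integral_prod _ h, PMF.integral_eq_sum]
  rfl

/-- Polynomials are integrable at all times. -/
theorem integrable_eval_stateLaw {C : PCFG L n m} (hC : C.FiniteMoments) (k : ℕ)
    (p : L → MvPolynomial (Fin n) ℝ) :
    Integrable (fun s => MvPolynomial.eval s.2 (p s.1)) (C.stateLaw k) := by
  induction k generalizing p with
  | zero => rw [stateLaw_zero]; exact integrable_dirac (by finiteness)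
  | succ k ih =>
    have hsnd : C.stateLaw (k + 1) = (C.stateLaw k ⊗ₘ C.step).map Prod.snd := by
      rw [← map_runLaw_pair, Measure.map_map measurable_snd (by fun_prop)]
      rfl
    rw [hsnd, integrable_map_measure (measurable_eval_state p).aestronglyMeasurable
      measurable_snd.aemeasurable]
    rw [Measure.integrable_compProd_iff
      ((measurable_eval_state p).comp measurable_snd).aestronglyMeasurable]
    refine ⟨.of_forall fun s => integrable_eval_step hC p s, ?_⟩
    -- The bound `|p| ≤ p² + 1` replaces the absolute value by a polynomial. Its one-step
    -- expectation is again a polynomial, to which the induction hypothesis, stated for all `p`,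
    -- applies.
    let q : Fin C.numTrans → L → MvPolynomial (Fin n) ℝ := fun τ _ =>
      ∑ ℓ', MvPolynomial.C (C.prob τ ℓ').toReal * (C.update τ).symExp (p ℓ' ^ 2 + 1)
    -- The enabled transition depends on the state; summing absolute values over all transitions
    -- gives a bound without case distinction.
    have hq : Integrable (fun s => ∑ τ, |MvPolynomial.eval s.2 (q τ s.1)|) (C.stateLaw k) :=
      integrable_finsetSum _ fun τ _ => (ih (q τ)).abs
    refine hq.mono' ?_ (.of_forall fun s => ?_)
    · exact (((measurable_eval_state p).comp measurable_snd).norm.stronglyMeasurable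
        |>.integral_kernel_prod_right').aestronglyMeasurable
    obtain ⟨τ, hτ, -⟩ := C.existsUnique_enabled s.1 s.2
    rw [Real.norm_of_nonneg (integral_nonneg fun _ => norm_nonneg _)]
    calc ∫ s', ‖MvPolynomial.eval s'.2 (p s'.1)‖ ∂C.step s
        ≤ ∫ s', MvPolynomial.eval s'.2 (p s'.1 ^ 2 + 1) ∂C.step s := by
          refine integral_mono (integrable_eval_step hC p s).norm
            (integrable_eval_step hC (fun ℓ => p ℓ ^ 2 + 1) s) fun s' => ?_
          simp only [map_add, map_pow, map_one, Real.norm_eq_abs]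
          rw [← sq_abs]
          nlinarith [sq_nonneg (|MvPolynomial.eval s'.2 (p s'.1)| - 1),
            abs_nonneg (MvPolynomial.eval s'.2 (p s'.1))]
      _ = MvPolynomial.eval s.2 (q τ s.1) := by
          rw [integral_eval_step hC (fun ℓ => p ℓ ^ 2 + 1) hτ, map_sum]
          refine Finset.sum_congr rfl fun ℓ' _ => ?_
          rw [map_mul, MvPolynomial.eval_C, (hC τ).integral_eval]
      _ ≤ |MvPolynomial.eval s.2 (q τ s.1)| := le_abs_self _
      _ ≤ ∑ τ, |MvPolynomial.eval s.2 (q τ s.1)| :=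
          Finset.single_le_sum (f := fun τ => |MvPolynomial.eval s.2 (q τ s.1)|)
            (fun τ _ => abs_nonneg _) (Finset.mem_univ τ)

theorem integrable_eval_run {C : PCFG L n m} (hC : C.FiniteMoments) (k : ℕ)
    (p : L → MvPolynomial (Fin n) ℝ) :
    Integrable (fun ρ => MvPolynomial.eval (ρ k).2 (p (ρ k).1)) C.runLaw :=
  (integrable_eval_stateLaw hC k p).comp_measurable (measurable_pi_apply k)

theorem ae_stateLaw_reachable (C : PCFG L n m) {I : L → PolyPred n} (hI : C.IsInvariant I) (k : ℕ) :
    ∀ᵐ s ∂C.stateLaw k, (I s.1).Holds s.2 := by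
  have hm : MeasurableSet {s : L × (Fin n → ℝ) | (I s.1).Holds s.2} := by
    have h : {s : L × (Fin n → ℝ) | (I s.1).Holds s.2} =
        ⋃ ℓ, {s | s.1 = ℓ} ∩ {s | (I ℓ).Holds s.2} := by
      ext s
      simp
    rw [h]
    exact MeasurableSet.iUnion fun ℓ => (measurable_fst (measurableSet_singleton ℓ)).inter
      (measurable_snd (I ℓ).measurableSet_holds)
  rw [stateLaw, ae_map_iff (f := fun ρ : ℕ → L × (Fin n → ℝ) => ρ k) (measurable_pi_apply k).aemeasurable hm]
  filter_upwards [C.ae_isRun] with ρ hρ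
  exact hI _ (hρ.reachable k)

/-- If a polynomial state function does not increase in expectation in one step from the states of
an invariant, then its expectation does not increase along the process. -/
theorem integral_eval_run_le {C : PCFG L n m} (hC : C.FiniteMoments) {I : L → PolyPred n}
    (hI : C.IsInvariant I) (p : L → MvPolynomial (Fin n) ℝ)
    (hp : ∀ τ x, (I (C.src τ)).Holds x → (C.guard τ).Holds x →
      ∑ ℓ', (C.prob τ ℓ').toReal * ∫ N, MvPolynomial.eval N (p ℓ') ∂(C.update τ).next x
        ≤ MvPolynomial.eval x (p (C.src τ))) (k : ℕ) :
    ∫ ρ, MvPolynomial.eval (ρ k).2 (p (ρ k).1) ∂C.runLaw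
      ≤ MvPolynomial.eval C.xInit (p C.lInit) := by
  have hmap : ∀ k, ∫ ρ, MvPolynomial.eval (ρ k).2 (p (ρ k).1) ∂C.runLaw =
      ∫ s, MvPolynomial.eval s.2 (p s.1) ∂C.stateLaw k := fun k =>
    (integral_map (φ := fun ρ : ℕ → L × (Fin n → ℝ) => ρ k) (measurable_pi_apply k).aemeasurable
      (measurable_eval_state p).aestronglyMeasurable).symm
  induction k with
  | zero => rw [hmap, stateLaw_zero, integral_dirac]
  | succ k ih =>
    refine le_trans ?_ ih
    have hm : Measurable fun z : (L × (Fin n → ℝ)) × (L × (Fin n → ℝ)) =>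
        MvPolynomial.eval z.2.2 (p z.2.1) := (measurable_eval_state p).comp measurable_snd
    have hpair : Measurable fun ρ : ℕ → L × (Fin n → ℝ) => (ρ k, ρ (k + 1)) := by fun_prop
    have hint : Integrable (fun z : (L × (Fin n → ℝ)) × (L × (Fin n → ℝ)) =>
        MvPolynomial.eval z.2.2 (p z.2.1)) (C.stateLaw k ⊗ₘ C.step) := by
      rw [← map_runLaw_pair, integrable_map_measure hm.aestronglyMeasurable
        hpair.aemeasurable]
      exact integrable_eval_run hC (k + 1) p
    have hsucc : ∫ ρ, MvPolynomial.eval (ρ (k + 1)).2 (p (ρ (k + 1)).1) ∂C.runLaw =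
        ∫ s, ∫ s', MvPolynomial.eval s'.2 (p s'.1) ∂C.step s ∂C.stateLaw k := by
      rw [← Measure.integral_compProd hint, ← map_runLaw_pair, integral_map hpair.aemeasurable
        hm.aestronglyMeasurable]
    rw [hsucc, hmap]
    -- The drift inequality is available only on the invariant, hence the comparison almost
    -- everywhere for the state law.
    refine integral_mono_ae (by simpa using MeasureTheory.Integrable.integral_compProd hint) (integrable_eval_stateLaw hC k p) ?_
    filter_upwards [C.ae_stateLaw_reachable hI k] with s hs
    obtain ⟨τ, hτ, -⟩ := C.existsUnique_enabled s.1 s.2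
    rw [integral_eval_step hC p hτ, ← hτ.1]
    exact hp τ s.2 (hτ.1 ▸ hs) hτ.2

end RunLaw

end PCFG

/-- A polynomial grows at most polynomially in the size of its arguments. -/
theorem MvPolynomial.exists_abs_eval_le {σ : Type*} (p : MvPolynomial σ ℝ) :
    ∃ (A : ℝ) (D : ℕ), 0 ≤ A ∧ ∀ (x : σ → ℝ) (R : ℝ), 0 ≤ R → (∀ j, |x j| ≤ R) →
      |eval x p| ≤ A * (1 + R) ^ D := by
  induction p using MvPolynomial.induction_on with
  | C a => exact ⟨|a|, 0, abs_nonneg a, fun x R _ _ => by simp⟩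
  | add p q hp hq =>
    obtain ⟨A, D, hA, hp⟩ := hp
    obtain ⟨B, E, hB, hq⟩ := hq
    refine ⟨A + B, D + E, add_nonneg hA hB, fun x R hR hx => ?_⟩
    have h1 : (1 : ℝ) ≤ 1 + R := by linarith
    calc |eval x (p + q)| ≤ |eval x p| + |eval x q| := by rw [map_add]; exact abs_add_le _ _
      _ ≤ A * (1 + R) ^ D + B * (1 + R) ^ E := add_le_add (hp x R hR hx) (hq x R hR hx)
      _ ≤ A * (1 + R) ^ (D + E) + B * (1 + R) ^ (D + E) := by
          gcongr <;> first | exact h1 | omega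
      _ = (A + B) * (1 + R) ^ (D + E) := by ring
  | mul_X p j hp =>
    obtain ⟨A, D, hA, hp⟩ := hp
    refine ⟨A, D + 1, hA, fun x R hR hx => ?_⟩
    rw [map_mul, eval_X, abs_mul, pow_succ, ← mul_assoc]
    exact mul_le_mul (hp x R hR hx) ((hx j).trans (by linarith)) (abs_nonneg _) (by positivity)

/-! ### Integrable domination of the potential up to termination -/

namespace PCFG

variable {L : Type*} {n m : ℕ}

namespace IsRun

variable {C : PCFG L n m} {ρ : ℕ → L × (Fin n → ℝ)}

/-- A terminating run is stationary from its termination time on. -/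
theorem exists_termTime_eq (h : C.IsRun ρ) (hterm : ∃ i, (ρ i).1 = C.lOut) :
    ∃ t : ℕ, C.termTime ρ = t ∧ (∀ k, (ρ k).1 = C.lOut ↔ t ≤ k) ∧ ∀ k, ρ k = ρ (min k t) := by
  obtain ⟨i, hi⟩ := hterm
  obtain ⟨t, ht⟩ := ENat.ne_top_iff_exists.1
    (((h.termTime_le_iff i).2 hi).trans_lt (ENat.natCast_lt_top i)).ne
  have hk : ∀ k, (ρ k).1 = C.lOut ↔ t ≤ k := fun k => by
    rw [← h.termTime_le_iff, ← ht, Nat.cast_le]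
  refine ⟨t, ht.symm, hk, fun k => ?_⟩
  rcases le_total k t with hkt | hkt
  · rw [min_eq_left hkt]
  · rw [min_eq_right hkt, h.eq_of_le ((hk t).2 le_rfl) hkt]

theorem abs_le_of_boundedUpdates (h : C.IsRun ρ) {M : ℝ}
    (hM : ∀ τ s, C.Reachable s → C.Enabled τ s →
      ∀ y ∈ (C.update τ).nextSupport s.2, ∀ j, |y j - s.2 j| ≤ M) (k : ℕ) (j : Fin n) :
    |(ρ k).2 j| ≤ ∑ i, |C.xInit i| + M * k := by
  induction k with
  | zero =>
    rw [h.1]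
    simpa using Finset.single_le_sum (f := fun i => |C.xInit i|) (fun i _ => abs_nonneg _)
      (Finset.mem_univ j)
  | succ k ih =>
    obtain ⟨τ, hτ, -, hs⟩ := h.2 k
    have := hM τ _ (h.reachable k) hτ _ hs j
    have h2 := abs_sub_abs_le_abs_sub ((ρ (k + 1)).2 j) ((ρ k).2 j)
    push_cast
    linarith

end IsRun

theorem measurable_out (C : PCFG L n m) : Measurable C.out :=
  measurable_pi_lambda _ fun _ => measurable_pi_apply _

/-- Writes a sum up to the random termination time as a series of indicators, so that Tonelli turns
its expectation into `∑ w k · P(T > k)`. -/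
theorem tsum_indicator_eq_sum {C : PCFG L n m} {ρ : ℕ → L × (Fin n → ℝ)} {t : ℕ}
    (ht : ∀ k, (ρ k).1 = C.lOut ↔ t ≤ k) (w : ℕ → ℝ≥0∞) :
    ∑' k, {ρ : ℕ → L × (Fin n → ℝ) | (ρ k).1 ≠ C.lOut}.indicator (fun _ => w k) ρ =
      ∑ k ∈ Finset.range t, w k := by
  rw [tsum_eq_sum (s := Finset.range t)]
  · refine Finset.sum_congr rfl fun k hk => Set.indicator_of_mem ?_ _
    change ¬ _
    rw [ht]
    exact not_le.2 (Finset.mem_range.1 hk)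
  · intro k hk
    refine Set.indicator_of_notMem ?_ _
    change ¬ ¬ _
    rw [not_not, ht]
    exact not_lt.1 (mt Finset.mem_range.2 hk)

section Domination

variable [MeasurableSpace L] [DiscreteMeasurableSpace L] {C : PCFG L n m}

theorem measurableSet_fst_ne_lOut (C : PCFG L n m) (k : ℕ) :
    MeasurableSet {ρ : ℕ → L × (Fin n → ℝ) | (ρ k).1 ≠ C.lOut} :=
  (measurable_pi_apply k).fst (MeasurableSet.of_discrete (s := {ℓ | ℓ ≠ C.lOut}))

variable [Fintype L]

/-- Domination of a state function along almost all runs, from a bound on its growth and on the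
tails of the termination time. -/
theorem exists_integrable_bound_of_tsum (hterm : C.TerminatesAS)
    (F : L × (Fin n → ℝ) → ℝ) {a : ℝ} {w : ℕ → ℝ} (ha : 0 ≤ a) (hw : ∀ k, 0 ≤ w k)
    (hF : ∀ ρ, C.IsRun ρ → ∀ k, |F (ρ k)| ≤ a + ∑ i ∈ Finset.range k, w i)
    (hsum : ∑' k, ENNReal.ofReal (w k) * C.runLaw {ρ | (ρ k).1 ≠ C.lOut} ≠ ∞) :
    ∃ G : (ℕ → L × (Fin n → ℝ)) → ℝ, Integrable G C.runLaw ∧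
      ∀ k, ∀ᵐ ρ ∂C.runLaw, |F (ρ k)| ≤ G ρ := by
  -- This is `a + ∑_{k < T} w k` with `T` the termination time; its integral is `a` plus the series
  -- assumed finite.
  let G : (ℕ → L × (Fin n → ℝ)) → ℝ≥0∞ := fun ρ => ENNReal.ofReal a +
    ∑' k, {ρ : ℕ → L × (Fin n → ℝ) | (ρ k).1 ≠ C.lOut}.indicator
      (fun _ => ENNReal.ofReal (w k)) ρ
  have hmeas : ∀ k, Measurable ({ρ : ℕ → L × (Fin n → ℝ) | (ρ k).1 ≠ C.lOut}.indicator
      (fun _ => ENNReal.ofReal (w k))) := fun k =>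
    measurable_const.indicator (C.measurableSet_fst_ne_lOut k)
  have hG : Measurable G := measurable_const.add (.tsum hmeas)
  have hint : ∫⁻ ρ, G ρ ∂C.runLaw ≠ ∞ := by
    rw [lintegral_add_left measurable_const, lintegral_tsum fun k => (hmeas k).aemeasurable]
    simp only [lintegral_indicator_const (C.measurableSet_fst_ne_lOut _), lintegral_const,
      measure_univ, mul_one]
    exact ENNReal.add_ne_top.2 ⟨ENNReal.ofReal_ne_top, hsum⟩
  refine ⟨fun ρ => (G ρ).toReal, integrable_toReal_of_lintegral_ne_top hG.aemeasurable hint,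
    fun k => ?_⟩
  filter_upwards [C.ae_isRun, hterm] with ρ hρ hρt
  obtain ⟨t, -, ht, hstat⟩ := hρ.exists_termTime_eq hρt
  have hGρ : (G ρ).toReal = a + ∑ i ∈ Finset.range t, w i := by
    simp only [G]
    rw [tsum_indicator_eq_sum ht, ← ENNReal.ofReal_sum_of_nonneg fun i _ => hw i,
      ← ENNReal.ofReal_add ha (Finset.sum_nonneg fun i _ => hw i),
      ENNReal.toReal_ofReal (add_nonneg ha (Finset.sum_nonneg fun i _ => hw i))]
  -- The run is frozen after time `t`, so only growth up to `min k t ≤ t` counts.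
  rw [hGρ, hstat k]
  refine (hF ρ hρ _).trans (add_le_add_right ?_ a)
  exact Finset.sum_le_sum_of_subset_of_nonneg (Finset.range_mono (min_le_right k t))
    fun i _ _ => hw i

theorem tsum_tail_eq (hterm : C.TerminatesAS) :
    ∑' k, C.runLaw {ρ | (ρ k).1 ≠ C.lOut} = ∫⁻ ρ, (C.termTime ρ : ℝ≥0∞) ∂C.runLaw := by
  calc ∑' k, C.runLaw {ρ | (ρ k).1 ≠ C.lOut}
      = ∫⁻ ρ, ∑' k, {ρ : ℕ → L × (Fin n → ℝ) | (ρ k).1 ≠ C.lOut}.indicator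
          (fun _ => (1 : ℝ≥0∞)) ρ ∂C.runLaw := by
        rw [lintegral_tsum fun k =>
          (measurable_const.indicator (C.measurableSet_fst_ne_lOut k)).aemeasurable]
        simp only [lintegral_indicator_const (C.measurableSet_fst_ne_lOut _), one_mul]
    _ = _ := by
        refine lintegral_congr_ae ?_
        filter_upwards [C.ae_isRun, hterm] with ρ hρ hρt
        obtain ⟨t, ht, ht', -⟩ := hρ.exists_termTime_eq hρt
        rw [tsum_indicator_eq_sum ht' fun _ => 1, ht]
        simp

theorem runLaw_fst_ne_lOut (C : PCFG L n m) (k : ℕ) :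
    C.runLaw {ρ | (ρ k).1 ≠ C.lOut} = C.runLaw {ρ | (k : ℕ∞) < C.termTime ρ} := by
  refine measure_congr ?_
  filter_upwards [C.ae_isRun] with ρ hρ
  refine propext ?_
  change ¬ _ ↔ _ < _
  rw [← hρ.termTime_le_iff, not_le]

/-- Under each of the optional-stopping conditions the values of `η(ℓ, x) + f(x^out)` along a run
have an integrable bound. -/
theorem exists_integrable_bound {K : ℕ} {I : L → PolyPred n} {f : MvPolynomial (Fin m) ℝ}
    {η : L → MvPolynomial (Fin n) ℝ} {c : ℝ} {mode : OSTMode} (hC : C.FiniteMoments)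
    (hterm : C.TerminatesAS) (hinv : C.IsInvariant I) (hmode : mode.Requires C) (hc : 0 < c)
    (host : C.OSTConstraint K I f η c mode) :
    ∃ G : (ℕ → L × (Fin n → ℝ)) → ℝ, Integrable G C.runLaw ∧
      ∀ k, ∀ᵐ ρ ∂C.runLaw, |MvPolynomial.eval (ρ k).2 (C.potential η f (ρ k).1)| ≤ G ρ := by
  cases mode with
  | C1 =>
    obtain ⟨N, hN⟩ := hmode
    -- Runs are stationary from time `N` on, so finitely many times suffice, and the potential is
    -- integrable at each of them.
    refine ⟨fun ρ => ∑ k ∈ Finset.range (N + 1),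
      |MvPolynomial.eval (ρ k).2 (C.potential η f (ρ k).1)|,
      integrable_finsetSum _ fun k _ => (integrable_eval_run hC k _).abs, fun k => ?_⟩
    filter_upwards [C.ae_isRun, hN] with ρ hρ hρN
    have hk : ρ k = ρ (min k N) := by
      rcases le_total k N with h | h
      · rw [min_eq_left h]
      · rw [min_eq_right h, hρ.eq_of_le ((hρ.termTime_le_iff N).1 hρN) h]
    rw [hk]
    exact Finset.single_le_sum
      (f := fun k => |MvPolynomial.eval (ρ k).2 (C.potential η f (ρ k).1)|)
      (fun _ _ => abs_nonneg _) (Finset.mem_range.2 (Nat.lt_succ_of_le (min_le_right k N)))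
  | C2 =>
    refine ⟨fun _ => c, integrable_const c, fun k => ?_⟩
    filter_upwards [C.ae_isRun] with ρ hρ
    exact host.abs_potential_le (hinv _ (hρ.reachable k))
  | C3 =>
    -- The potential moves by at most `c` per step, so constant weights work and the series is `c ·
    -- 𝔼[T]`.
    refine exists_integrable_bound_of_tsum hterm
      (fun s => MvPolynomial.eval s.2 (C.potential η f s.1))
      (a := |MvPolynomial.eval C.xInit (C.potential η f C.lInit)|) (w := fun _ => c)
      (abs_nonneg _) (fun _ => hc.le) (fun ρ hρ k => ?_) ?_
    · induction k with
      | zero => simp [hρ.1]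
      | succ k ih =>
        have h := host.abs_potential_sub_le (hinv _ (hρ.reachable k)) (hρ.2 k)
        have h' := abs_sub_abs_le_abs_sub
          (MvPolynomial.eval (ρ (k + 1)).2 (C.potential η f (ρ (k + 1)).1))
          (MvPolynomial.eval (ρ k).2 (C.potential η f (ρ k).1))
        rw [Finset.sum_range_succ]
        linarith
    · rw [ENNReal.tsum_mul_left, tsum_tail_eq hterm]
      exact ENNReal.mul_ne_top ENNReal.ofReal_ne_top (ne_of_lt hmode)
  | C4 =>
    obtain ⟨⟨M, hM, hupd⟩, c₁, c₂, hc₂, htail⟩ := hmode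
    -- One polynomial dominates the absolute potentials of all locations, so a single pair `A`, `D`
    -- serves them all.
    obtain ⟨A, D, hA, hpoly⟩ :=
      MvPolynomial.exists_abs_eval_le (∑ ℓ, (C.potential η f ℓ ^ 2 + 1))
    set r : ℝ := ∑ i, |C.xInit i| with hr
    have hr0 : 0 ≤ r := Finset.sum_nonneg fun i _ => abs_nonneg _
    set B : ℝ := A * (1 + r + M) ^ D with hBdef
    have hB : 0 ≤ B := by positivity
    have hgrow : ∀ ρ, C.IsRun ρ → ∀ k : ℕ,
        |MvPolynomial.eval (ρ k).2 (C.potential η f (ρ k).1)| ≤ B * (k + 1) ^ D := by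
      intro ρ hρ k
      have h₁ := hpoly (ρ k).2 (r + M * k) (by positivity) (hρ.abs_le_of_boundedUpdates hupd k)
      have h₂ : |MvPolynomial.eval (ρ k).2 (C.potential η f (ρ k).1)| ≤
          MvPolynomial.eval (ρ k).2 (∑ ℓ, (C.potential η f ℓ ^ 2 + 1)) := by
        simp only [map_sum, map_add, map_pow, map_one]
        refine le_trans ?_ (Finset.single_le_sum
          (f := fun ℓ => MvPolynomial.eval (ρ k).2 (C.potential η f ℓ) ^ 2 + 1)
          (fun ℓ _ => by positivity) (Finset.mem_univ (ρ k).1))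
        rw [← sq_abs]
        nlinarith [sq_nonneg (|MvPolynomial.eval (ρ k).2 (C.potential η f (ρ k).1)| - 1),
          abs_nonneg (MvPolynomial.eval (ρ k).2 (C.potential η f (ρ k).1))]
      refine h₂.trans ((le_abs_self _).trans (h₁.trans ?_))
      -- Uses `1 + (r + M k) ≤ (1 + r + M)(k + 1)`.
      rw [hBdef, mul_assoc, ← mul_pow]
      gcongr
      have : 0 ≤ (k : ℝ) := k.cast_nonneg
      nlinarith [mul_nonneg hr0 this]
    refine exists_integrable_bound_of_tsum hterm
      (fun s => MvPolynomial.eval s.2 (C.potential η f s.1))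
      -- The last weight alone bounds the growth: at time `k + 1` the summand of index `k` is `B (k
      -- + 2) ^ D`. Time `0` is covered by `a = B`.
      (a := B) (w := fun k => B * (k + 2) ^ D) hB (fun k => by positivity)
      (fun ρ hρ k => ?_) ?_
    · refine (hgrow ρ hρ k).trans ?_
      cases k with
      | zero => simp
      | succ k =>
        have h := Finset.single_le_sum (f := fun i : ℕ => B * ((i : ℝ) + 2) ^ D)
          (fun i _ => by positivity) (Finset.self_mem_range_succ k)
        push_cast
        rw [add_assoc, one_add_one_eq_two]
        linarith
    · have hexp : Summable fun k : ℕ => ((k : ℝ) + 2) ^ D * Real.exp (-c₂ * k) := by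
        -- The standard series shifted by two, with the factor `exp (2 c₂)` compensating the shift
        -- in the exponent.
        have h := ((summable_nat_add_iff 2).2
          (Real.summable_pow_mul_exp_neg_nat_mul D hc₂)).mul_right (Real.exp (c₂ * 2))
        refine h.congr fun k => ?_
        rw [mul_assoc, ← Real.exp_add]
        push_cast
        congr 2
        ring
      have hsum : Summable fun k : ℕ =>
          B * ((k : ℝ) + 2) ^ D * C.runLaw.real {ρ | (ρ k).1 ≠ C.lOut} := by
        -- The tail estimate is assumed only for large `k`.
        refine Summable.of_norm_bounded_eventually_nat (hexp.mul_left (B * c₁)) ?_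
        filter_upwards [htail] with k hk
        have hk' : C.runLaw.real {ρ | (ρ k).1 ≠ C.lOut} ≤ c₁ * Real.exp (-c₂ * k) := by
          rw [measureReal_def, runLaw_fst_ne_lOut]
          exact hk
        rw [Real.norm_of_nonneg (by positivity)]
        calc _ ≤ B * ((k : ℝ) + 2) ^ D * (c₁ * Real.exp (-c₂ * k)) := by gcongr
          _ = _ := by ring
      have heq : ∀ k : ℕ, ENNReal.ofReal (B * ((k : ℝ) + 2) ^ D) *
          C.runLaw {ρ | (ρ k).1 ≠ C.lOut} = ENNReal.ofReal
            (B * ((k : ℝ) + 2) ^ D * C.runLaw.real {ρ | (ρ k).1 ≠ C.lOut}) := fun k => by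
        rw [ENNReal.ofReal_mul (p := B * ((k : ℝ) + 2) ^ D) (by positivity), ofReal_measureReal]
      simp only [heq]
      exact hsum.tsum_ofReal_ne_top

end Domination

/-! ### Expected outputs by dominated convergence -/

section Output

variable [Fintype L] [MeasurableSpace L] [DiscreteMeasurableSpace L] {C : PCFG L n m}

theorem ae_tendsto_runOut (hterm : C.TerminatesAS) :
    ∀ᵐ ρ ∂C.runLaw, ∃ t : ℕ, ∀ k, t ≤ k → (ρ k).1 = C.lOut ∧ C.out (ρ k).2 = C.runOut ρ := by
  filter_upwards [C.ae_isRun, hterm] with ρ hρ hρt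
  obtain ⟨t, -, ht, -⟩ := hρ.exists_termTime_eq hρt
  exact ⟨t, fun k hk => ⟨(ht k).2 hk, (hρ.runOut_eq ((ht k).2 hk)).symm⟩⟩

/-- The output is the almost sure limit of the eventually constant sequence of projected states,
which avoids analysing the random index in `runOut`. -/
theorem aemeasurable_runOut (hterm : C.TerminatesAS) : AEMeasurable C.runOut C.runLaw := by
  refine aemeasurable_of_tendsto_metrizable_ae Filter.atTop (f := fun k ρ => C.out (ρ k).2)
    (fun k => (C.measurable_out.comp (measurable_pi_apply k).snd).aemeasurable) ?_
  filter_upwards [ae_tendsto_runOut hterm] with ρ ⟨t, ht⟩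
  exact tendsto_const_nhds.congr' (Filter.eventually_atTop.2 ⟨t, fun k hk => ((ht k hk).2).symm⟩)

theorem integral_outputLaw (hterm : C.TerminatesAS) {g : (Fin m → ℝ) → ℝ} (hg : Measurable g) :
    ∫ y, g y ∂C.outputLaw = ∫ ρ, g (C.runOut ρ) ∂C.runLaw := by
  have h : C.outputLaw = C.runLaw.map C.runOut := by
    rw [outputLaw, Measure.restrict_eq_self_of_ae_mem 
      (s := {ρ : ℕ → L × (Fin n → ℝ) | ∃ i, (ρ i).1 = C.lOut}) hterm]
  rw [h, integral_map (aemeasurable_runOut hterm) hg.aestronglyMeasurable]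

theorem ae_runOut_mem_outputSet (hterm : C.TerminatesAS) {I : L → PolyPred n}
    (hinv : C.IsInvariant I) : ∀ᵐ ρ ∂C.runLaw, C.runOut ρ ∈ C.outputSet I := by
  filter_upwards [C.ae_isRun, ae_tendsto_runOut hterm] with ρ hρ ⟨t, ht⟩
  obtain ⟨h₁, h₂⟩ := ht t le_rfl
  exact ⟨(ρ t).2, h₁ ▸ hinv _ (hρ.reachable t), h₂⟩

/-- The expected output value is the limit of the expected potentials. -/
theorem tendsto_integral_potential {K : ℕ} {I : L → PolyPred n} {f : MvPolynomial (Fin m) ℝ}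
    {η : L → MvPolynomial (Fin n) ℝ} {c : ℝ} {mode : OSTMode} (hC : C.FiniteMoments)
    (hterm : C.TerminatesAS) (hinv : C.IsInvariant I) (hmode : mode.Requires C) (hc : 0 < c)
    (host : C.OSTConstraint K I f η c mode) (hzero : C.ZeroConstraint K I η) :
    Filter.Tendsto
      (fun k => ∫ ρ, MvPolynomial.eval (ρ k).2 (C.potential η f (ρ k).1) ∂C.runLaw) Filter.atTop
      (nhds (∫ ρ, MvPolynomial.eval (C.runOut ρ) f ∂C.runLaw)) := by
  obtain ⟨G, hG, hbound⟩ := exists_integrable_bound hC hterm hinv hmode hc host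
  refine tendsto_integral_of_dominated_convergence G
    (fun k => (integrable_eval_run hC k _).aestronglyMeasurable) hG hbound ?_
  filter_upwards [C.ae_isRun, ae_tendsto_runOut hterm] with ρ hρ ⟨t, ht⟩
  refine tendsto_const_nhds.congr' (Filter.eventually_atTop.2 ⟨t, fun k hk => ?_⟩)
  obtain ⟨h₁, h₂⟩ := ht k hk
  dsimp only
  rw [eval_potential, h₁, hzero.eval_eq_zero (h₁ ▸ hinv _ (hρ.reachable k)), zero_add, h₂]

/-- An upper expectation supermartingale bounds the expected output value from above. -/
theorem IsUESM.integral_runOut_le {K : ℕ} {I : L → PolyPred n} {f : MvPolynomial (Fin m) ℝ}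
    {U : L → MvPolynomial (Fin n) ℝ} {c : ℝ} {mode : OSTMode}
    (hU : C.IsUESM I (fun x => MvPolynomial.eval x f) (fun ℓ x => MvPolynomial.eval x (U ℓ)))
    (hC : C.FiniteMoments) (hmode : mode.Requires C) (hc : 0 < c)
    (host : C.OSTConstraint K I f U c mode) (hzero : C.ZeroConstraint K I U) :
    ∫ ρ, MvPolynomial.eval (C.runOut ρ) f ∂C.runLaw ≤
      MvPolynomial.eval C.xInit (U C.lInit) + MvPolynomial.eval (C.out C.xInit) f := by
  rw [← eval_potential]
  refine le_of_tendsto'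
    (tendsto_integral_potential hC hU.terminates hU.invariant hmode hc host hzero) fun k => ?_
  refine integral_eval_run_le hC hU.invariant (C.potential U f) (fun τ x hI hG => ?_) k
  have h := hU.decrease τ x hI hG
  rw [nextExp] at h
  simp only [eval_potential]
  linarith

/-- A lower expectation submartingale bounds the expected output value from below. -/
theorem IsLESM.le_integral_runOut {K : ℕ} {I : L → PolyPred n} {f : MvPolynomial (Fin m) ℝ}
    {V : L → MvPolynomial (Fin n) ℝ} {c : ℝ} {mode : OSTMode}
    (hV : C.IsLESM I (fun x => MvPolynomial.eval x f) (fun ℓ x => MvPolynomial.eval x (V ℓ)))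
    (hC : C.FiniteMoments) (hmode : mode.Requires C) (hc : 0 < c)
    (host : C.OSTConstraint K I f V c mode) (hzero : C.ZeroConstraint K I V) :
    MvPolynomial.eval C.xInit (V C.lInit) + MvPolynomial.eval (C.out C.xInit) f ≤
      ∫ ρ, MvPolynomial.eval (C.runOut ρ) f ∂C.runLaw := by
  rw [← eval_potential]
  refine ge_of_tendsto'
    (tendsto_integral_potential hC hV.terminates hV.invariant hmode hc host hzero) fun k => ?_
  -- A submartingale is the negative of a supermartingale.
  have h := integral_eval_run_le hC hV.invariant (fun ℓ => -C.potential V f ℓ)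
    (fun τ x hI hG => ?_) k
  · simp only [map_neg, integral_neg] at h
    linarith
  · have h := hV.increase τ x hI hG
    rw [nextExp] at h
    simp only [map_neg, integral_neg, mul_neg, Finset.sum_neg_distrib, eval_potential]
    linarith

end Output

end PCFG

/-! ### The Lipschitz constraint -/

/-! ### Extension of 1-Lipschitz functions to all outputs -/

namespace OutMetric

variable {m : ℕ}

theorem d_nonneg (d : OutMetric) (u v : Fin m → ℝ) : 0 ≤ d.d u v := by
  cases d with
  | lp p hp => exact Real.rpow_nonneg (Finset.sum_nonneg fun i _ => by positivity) _
  | discrete => rw [OutMetric.d]; split_ifs <;> norm_num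
  | uniform => exact Real.iSup_nonneg fun i => abs_nonneg _

theorem d_comm (d : OutMetric) (u v : Fin m → ℝ) : d.d u v = d.d v u := by
  cases d with
  | lp p hp => simp only [OutMetric.d, abs_sub_comm]
  | discrete => simp only [OutMetric.d, eq_comm]
  | uniform => simp only [OutMetric.d, abs_sub_comm]

/-- Once `D` is the distance of some `PiLp` space, the real-valued Lipschitz extension theorem
applies there. The extension is continuous, and `toLp` is continuous from the product topology, so
measurability is automatic. -/
theorem exists_extension_of_dist_eq (q : ℝ≥0∞) [Fact (1 ≤ q)]
    {D : (Fin m → ℝ) → (Fin m → ℝ) → ℝ}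
    (hD : ∀ x y, dist (WithLp.toLp q x) (WithLp.toLp q y) = D x y) {O : Set (Fin m → ℝ)}
    {f : (Fin m → ℝ) → ℝ} (hf : ∀ x ∈ O, ∀ y ∈ O, |f x - f y| ≤ D x y) :
    ∃ g : (Fin m → ℝ) → ℝ, (Measurable g ∧ ∀ x y, |g x - g y| ≤ D x y) ∧ ∀ x ∈ O, g x = f x := by
  have hL : LipschitzOnWith 1 (fun z : PiLp q fun _ : Fin m => ℝ => f (WithLp.ofLp z))
      {z | WithLp.ofLp z ∈ O} := by
    refine LipschitzOnWith.of_dist_le_mul fun x hx y hy => ?_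
    rw [NNReal.coe_one, one_mul, Real.dist_eq]
    exact (hf _ hx _ hy).trans_eq (hD _ _).symm
  obtain ⟨g, hg, hgf⟩ := hL.extend_real
  refine ⟨fun x => g (WithLp.toLp q x), ⟨?_, fun x y => ?_⟩, fun x hx => ?_⟩
  · exact (hg.continuous.comp (PiLp.continuous_toLp q _)).measurable
  · rw [← hD, ← Real.dist_eq]
    simpa using hg.dist_le_mul (WithLp.toLp q x) (WithLp.toLp q y)
  · exact (hgf (x := WithLp.toLp q x) hx).symm

/-- A measurable function that is 1-Lipschitz on a set agrees on it with a measurable function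
that is 1-Lipschitz everywhere. -/
theorem exists_extension (d : OutMetric) {O : Set (Fin m → ℝ)} (hO : O.Nonempty)
    {f : (Fin m → ℝ) → ℝ} (hfm : Measurable f) (hf : ∀ x ∈ O, ∀ y ∈ O, |f x - f y| ≤ d.d x y) :
    ∃ g : (Fin m → ℝ) → ℝ, (Measurable g ∧ ∀ x y, |g x - g y| ≤ d.d x y) ∧
      ∀ x ∈ O, g x = f x := by
  cases d with
  | lp p hp =>
    have : Fact (1 ≤ (p : ℝ≥0∞)) := ⟨by exact_mod_cast hp⟩
    refine exists_extension_of_dist_eq (p : ℝ≥0∞) (fun x y => ?_) hf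
    have hp0 : 0 < (p : ℝ≥0∞).toReal := by
      rw [ENNReal.toReal_natCast]
      exact_mod_cast hp
    rw [PiLp.dist_eq_sum hp0]
    simp only [ENNReal.toReal_natCast, Real.rpow_natCast, Real.dist_eq, OutMetric.d]
  | uniform =>
    refine exists_extension_of_dist_eq ∞ (fun x y => ?_) hf
    rw [PiLp.dist_eq_iSup]
    simp only [Real.dist_eq, OutMetric.d]
  | discrete =>
    -- A 1-Lipschitz function for the discrete metric need not be Borel, so measurability must come
    -- from `f` itself. The oscillation of `f` on `O` is at most 1, hence clamping `f` to `[a, a +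
    -- 1]` with `a` its infimum on `O` changes nothing there.
    have hle : ∀ x ∈ O, ∀ y ∈ O, f x ≤ f y + 1 := fun x hx y hy => by
      have h := (le_abs_self _).trans (hf x hx y hy)
      rw [OutMetric.d] at h
      split_ifs at h <;> linarith
    have hbdd : BddBelow (f '' O) := by
      obtain ⟨x₀, hx₀⟩ := hO
      refine ⟨f x₀ - 1, ?_⟩
      rintro _ ⟨y, hy, rfl⟩
      linarith [hle x₀ hx₀ y hy]
    set a := sInf (f '' O)
    have hlow : ∀ x ∈ O, a ≤ f x := fun x hx => csInf_le hbdd ⟨x, hx, rfl⟩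
    have hupp : ∀ x ∈ O, f x ≤ a + 1 := fun x hx => by
      rw [← sub_le_iff_le_add]
      refine le_csInf (hO.image f) ?_
      rintro _ ⟨y, hy, rfl⟩
      linarith [hle x hx y hy]
    refine ⟨fun x => max a (min (a + 1) (f x)),
      ⟨measurable_const.max (measurable_const.min hfm), fun x y => ?_⟩, fun x hx => ?_⟩
    · rw [OutMetric.d]
      split_ifs with h
      · simp [h]
      · have h₁ : ∀ z, a ≤ max a (min (a + 1) (f z)) := fun z => le_max_left _ _
        have h₂ : ∀ z, max a (min (a + 1) (f z)) ≤ a + 1 := fun z =>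
          max_le (by linarith) (min_le_left _ _)
        rw [abs_le]
        constructor <;> linarith [h₁ x, h₁ y, h₂ x, h₂ y]
    · dsimp only
      rw [min_eq_right (hupp x hx), max_eq_right (hlow x hx)]

end OutMetric

/-! ### The encoded Lipschitz condition on the allowed outputs -/

section Lipschitz

variable {L₁ L₂ : Type*} {n₁ n₂ m : ℕ} {C₁ : PCFG L₁ n₁ m} {C₂ : PCFG L₂ n₂ m}

namespace LipVar

/-- The valuation of the Lipschitz constraints at two valuations of the program variables. -/
noncomputable def valuation (C₁ : PCFG L₁ n₁ m) (C₂ : PCFG L₂ n₂ m) (v : Fin n₁ → ℝ)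
    (w : Fin n₂ → ℝ) : LipVar n₁ n₂ m → ℝ
  | x i => v i
  | y i => w i
  | a j => |C₁.out v j - C₂.out w j|
  | A => ⨆ j, |C₁.out v j - C₂.out w j|

variable {v : Fin n₁ → ℝ} {w : Fin n₂ → ℝ}

theorem eval_diff (f : MvPolynomial (Fin m) ℝ) :
    MvPolynomial.eval (valuation C₁ C₂ v w) (diff C₁ C₂ f) =
      MvPolynomial.eval (C₁.out v) f - MvPolynomial.eval (C₂.out w) f := by
  rw [diff, map_sub, MvPolynomial.eval_rename, MvPolynomial.eval_rename, ← C₁.eval_liftOut,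
    ← C₂.eval_liftOut]
  rfl

theorem eval_diffIneqs_nonneg : ∀ h ∈ diffIneqs C₁ C₂,
    0 ≤ MvPolynomial.eval (valuation C₁ C₂ v w) h := by
  rintro h ⟨j, rfl | rfl⟩
  · simpa [valuation, PCFG.out] using le_abs_self (C₁.out v j - C₂.out w j)
  · simpa [valuation, PCFG.out, abs_sub_comm (v _)] using le_abs_self (C₂.out w j - C₁.out v j)

theorem eval_maxIneqs_nonneg : ∀ h ∈ (maxIneqs : Set (MvPolynomial (LipVar n₁ n₂ m) ℝ)),
    0 ≤ MvPolynomial.eval (valuation C₁ C₂ v w) h := by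
  rintro h ⟨j, rfl⟩
  simpa [valuation] using le_ciSup (f := fun j => |C₁.out v j - C₂.out w j|)
    (Set.finite_range _).bddAbove j

/-- The auxiliary variables are given their tightest values, `a j = |u j - v j|` and `A` the
supremum of these, which turns the right-hand sides into the `p`-th power of the distance or the
distance itself. -/
theorem Clause.sub_le {K : ℕ} {f : MvPolynomial (Fin m) ℝ}
    {Γ : Set (MvPolynomial (LipVar n₁ n₂ m) ℝ)} {d : OutMetric} (h : Clause K C₁ C₂ f Γ d)
    (hΓ : ∀ g ∈ Γ, 0 ≤ MvPolynomial.eval (valuation C₁ C₂ v w) g) :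
    MvPolynomial.eval (C₁.out v) f - MvPolynomial.eval (C₂.out w) f ≤
      d.d (C₁.out v) (C₂.out w) := by
  have hΓ' : ∀ g ∈ Γ ∪ diffIneqs C₁ C₂, 0 ≤ MvPolynomial.eval (valuation C₁ C₂ v w) g := by
    rintro g (hg | hg)
    · exact hΓ g hg
    · exact eval_diffIneqs_nonneg g hg
  cases d with
  | lp p hp =>
    have h := Handelman.eval_nonneg h hΓ'
    simp only [map_sub, map_sum, map_pow, eval_diff, MvPolynomial.eval_X, valuation,
      sub_nonneg] at h
    -- Taking `p`-th roots requires a nonnegative difference; a nonpositive one is bounded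
    -- trivially.
    rcases le_total (MvPolynomial.eval (C₁.out v) f - MvPolynomial.eval (C₂.out w) f) 0 with h0 | h0
    · exact h0.trans (OutMetric.d_nonneg _ _ _)
    · rw [← Real.pow_rpow_inv_natCast h0 (Nat.one_le_iff_ne_zero.1 hp)]
      simp only [OutMetric.d, one_div]
      exact Real.rpow_le_rpow (by positivity) h (by positivity)
  | discrete =>
    have h := Handelman.eval_nonneg h hΓ
    rw [map_sub, map_one, eval_diff] at h
    rw [OutMetric.d]
    -- The constraint gives only the bound 1; for equal outputs, at distance 0, the difference
    -- vanishes anyway.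
    split_ifs with he
    · rw [he, sub_self]
    · linarith
  | uniform =>
    have hΓ'' : ∀ g ∈ Γ ∪ diffIneqs C₁ C₂ ∪ maxIneqs,
        0 ≤ MvPolynomial.eval (valuation C₁ C₂ v w) g := by
      rintro g (hg | hg)
      · exact hΓ' g hg
      · exact eval_maxIneqs_nonneg g hg
    have h := Handelman.eval_nonneg h hΓ''
    rw [map_sub, MvPolynomial.eval_X, eval_diff] at h
    exact sub_nonneg.1 h

end LipVar

theorem LipConstraint.sub_le {K : ℕ} {I₁ : L₁ → PolyPred n₁} {I₂ : L₂ → PolyPred n₂}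
    {f : MvPolynomial (Fin m) ℝ} {d : OutMetric} (h : LipConstraint K C₁ C₂ I₁ I₂ f d)
    {u v : Fin m → ℝ} (hu : u ∈ C₁.outputSet I₁) (hv : v ∈ C₂.outputSet I₂) :
    MvPolynomial.eval u f - MvPolynomial.eval v f ≤ d.d u v := by
  obtain ⟨x, hx, rfl⟩ := hu
  obtain ⟨y, hy, rfl⟩ := hv
  obtain ⟨D₁, hD₁, hx⟩ := PolyPred.Holds.exists_mem_dnf hx
  obtain ⟨D₂, hD₂, hy⟩ := PolyPred.Holds.exists_mem_dnf hy
  refine (h D₁ hD₁ D₂ hD₂).sub_le ?_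
  rintro _ (⟨g, hg, rfl⟩ | ⟨g, hg, rfl⟩)
  · rw [MvPolynomial.eval_rename]
    exact hx g hg
  · rw [MvPolynomial.eval_rename]
    exact hy g hg

/-- Each constraint is one-sided and concerns an ordered pair of programs. The four together cover
every ordered pair of points in the union, and symmetry of the metric gives the absolute value. -/
theorem abs_eval_sub_le_of_lipConstraint {K : ℕ} {I₁ : L₁ → PolyPred n₁} {I₂ : L₂ → PolyPred n₂}
    {f : MvPolynomial (Fin m) ℝ} {d : OutMetric} (h₁₁ : LipConstraint K C₁ C₁ I₁ I₁ f d)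
    (h₂₂ : LipConstraint K C₂ C₂ I₂ I₂ f d) (h₁₂ : LipConstraint K C₁ C₂ I₁ I₂ f d)
    (h₂₁ : LipConstraint K C₂ C₁ I₂ I₁ f d) :
    ∀ u ∈ C₁.outputSet I₁ ∪ C₂.outputSet I₂, ∀ v ∈ C₁.outputSet I₁ ∪ C₂.outputSet I₂,
      |MvPolynomial.eval u f - MvPolynomial.eval v f| ≤ d.d u v := by
  have key : ∀ u ∈ C₁.outputSet I₁ ∪ C₂.outputSet I₂, ∀ v ∈ C₁.outputSet I₁ ∪ C₂.outputSet I₂,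
      MvPolynomial.eval u f - MvPolynomial.eval v f ≤ d.d u v := by
    rintro u (hu | hu) v (hv | hv)
    exacts [h₁₁.sub_le hu hv, h₁₂.sub_le hu hv, h₂₁.sub_le hu hv, h₂₂.sub_le hu hv]
  intro u hu v hv
  rw [abs_sub_le_iff]
  exact ⟨key u hu v hv, (key v hv u hu).trans_eq (d.d_comm v u)⟩

end Lipschitz

/-! ### The refutation theorem -/

theorem theorem4 {L₁ L₂ : Type*}
    [Fintype L₁] [MeasurableSpace L₁] [DiscreteMeasurableSpace L₁]
    [Fintype L₂] [MeasurableSpace L₂] [DiscreteMeasurableSpace L₂]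
    {n₁ n₂ m : ℕ} (C₁ : PCFG L₁ n₁ m) (C₂ : PCFG L₂ n₂ m)
    (hguard₁ : C₁.LinearGuards) (hguard₂ : C₂.LinearGuards)
    (hmom₁ : C₁.FiniteMoments) (hmom₂ : C₂.FiniteMoments)
    (hterm₁ : C₁.TerminatesAS) (hterm₂ : C₂.TerminatesAS)
    (I₁ : L₁ → PolyPred n₁) (I₂ : L₂ → PolyPred n₂)
    (hlin₁ : ∀ ℓ, (I₁ ℓ).IsLinear) (hlin₂ : ∀ ℓ, (I₂ ℓ).IsLinear)
    (hinv₁ : C₁.IsInvariant I₁) (hinv₂ : C₂.IsInvariant I₂)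
    (mode : OSTMode) (hmode₁ : mode.Requires C₁) (hmode₂ : mode.Requires C₂)
    (d : OutMetric) (hfin₁ : FiniteFirstMoment d.d C₁.outputLaw)
    (hfin₂ : FiniteFirstMoment d.d C₂.outputLaw)
    (ε : ℝ) (hε : 0 < ε) (deg K : ℕ) (f : MvPolynomial (Fin m) ℝ)
    (U : L₁ → MvPolynomial (Fin n₁) ℝ) (V : L₂ → MvPolynomial (Fin n₂) ℝ)
    (hans : AnswersNotClose C₁ C₂ I₁ I₂ deg K mode d ε f U V) :
    (∀ x ∈ C₁.outputSet I₁ ∪ C₂.outputSet I₂, ∀ y ∈ C₁.outputSet I₁ ∪ C₂.outputSet I₂,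
      |MvPolynomial.eval x f - MvPolynomial.eval y f| ≤ d.d x y) ∧
    C₁.IsUESM I₁ (fun x => MvPolynomial.eval x f) (fun ℓ x => MvPolynomial.eval x (U ℓ)) ∧
    C₂.IsLESM I₂ (fun x => MvPolynomial.eval x f) (fun ℓ x => MvPolynomial.eval x (V ℓ)) ∧
    ENNReal.ofReal ε ≤ kantorovich d.d C₁.outputLaw C₂.outputLaw ∧
    ¬ OutputClose C₁ C₂ d ε := by
  have hlip := abs_eval_sub_le_of_lipConstraint hans.lipschitz₁₁ hans.lipschitz₂₂
    hans.lipschitz₁₂ hans.lipschitz₂₁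
  have hU := PCFG.isUESM_of_constraints hmom₁ hterm₁ hinv₁ hans.zero_U hans.decrease_U
  have hV := PCFG.isLESM_of_constraints hmom₂ hterm₂ hinv₂ hans.zero_V hans.increase_V
  have hK : ENNReal.ofReal ε ≤ kantorovich d.d C₁.outputLaw C₂.outputLaw := by
    obtain ⟨c, hc, host₁, host₂⟩ := hans.ost
    have hle₁ := hU.integral_runOut_le hmom₁ hmode₁ hc host₁ hans.zero_U
    have hle₂ := hV.le_integral_runOut hmom₂ hmode₂ hc host₂ hans.zero_V
    have hmem₁ := PCFG.ae_runOut_mem_outputSet hterm₁ hinv₁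
    have hmem₂ := PCFG.ae_runOut_mem_outputSet hterm₂ hinv₂
    -- An almost sure property of a probability measure holds somewhere, so the set of allowed
    -- outputs is nonempty, as the extension requires.
    obtain ⟨ρ, hρ⟩ := hmem₁.exists
    obtain ⟨g, hg, hgf⟩ := d.exists_extension ⟨_, Or.inl hρ⟩
      (MvPolynomial.continuous_eval f).measurable hlip
    have hg₁ : ∫ y, g y ∂C₁.outputLaw =
        ∫ ρ, MvPolynomial.eval (C₁.runOut ρ) f ∂C₁.runLaw := by
      rw [PCFG.integral_outputLaw hterm₁ hg.1]
      exact integral_congr_ae (hmem₁.mono fun ρ hρ => hgf _ (Or.inl hρ))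
    have hg₂ : ∫ y, g y ∂C₂.outputLaw =
        ∫ ρ, MvPolynomial.eval (C₂.runOut ρ) f ∂C₂.runLaw := by
      rw [PCFG.integral_outputLaw hterm₂ hg.1]
      exact integral_congr_ae (hmem₂.mono fun ρ hρ => hgf _ (Or.inr hρ))
    refine le_trans (ENNReal.ofReal_le_ofReal ?_)
      (le_iSup₂ (f := fun (g : (Fin m → ℝ) → ℝ) (_ : Measurable g ∧ ∀ x y, |g x - g y| ≤ d.d x y) =>
        ENNReal.ofReal |∫ x, g x ∂C₁.outputLaw - ∫ x, g x ∂C₂.outputLaw|) g hg)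
    -- The certified gap is the second expectation minus the first.
    rw [hg₁, hg₂, abs_sub_comm]
    refine le_trans ?_ (le_abs_self _)
    linarith [hans.similarity]
  exact ⟨hlip, hU, hV, hK, not_lt.2 hK⟩
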